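/- Let $f$ be a transcendental (i.e. non-rational) meromorphic function in the complex plane $\mathbf{C}$, regarded as a map into the Riemann sphere $\overline{\mathbf{C}}=\mathbf{C}\cup\{\infty\}$. A critical point of $f$ is a point at which $f'$ vanishes or a multiple pole of $f$, and a critical value is the image $f(z)\in\overline{\mathbf{C}}$ of a critical point $z$. A point $a\in\overline{\mathbf{C}}$ is an asymptotic value of $f$ if there is a curve $\gamma:[0,\infty)\to\mathbf{C}$ with $\gamma(t)\to\infty$ and $f(\gamma(t))\to a$ as $t\to\infty$. A singular value is a critical value or an asymptotic value. Let $T(r,f)$ denote the Nevanlinna characteristic of $f$. If $f$ has only finitely many singular values and at least one of them is an asymptotic value, then $$\liminf_{r\to\infty}\frac{T(r,f)}{\sqrt r}>0$$ (the lower limit may be $+\infty$). In particular, this inequality holds for every transcendental entire function with finitely many singular values. -/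

import Mathlib

open Filter Topology

namespace SingularValues

/-- The map from the plane to the Riemann sphere `OnePoint ℂ` defined by a meromorphic function
`f`: its value at `z` is the limit of `f` at `z`, which is `∞` exactly when `z` is a pole. It does
not depend on the values that `f : ℂ → ℂ` takes at poles and removable singularities. -/
noncomputable def sphereMap (f : ℂ → ℂ) (z : ℂ) : OnePoint ℂ :=
  limUnder (𝓝[≠] z) (fun w => (f w : OnePoint ℂ))

/-- `z` is a critical point of the meromorphic function `f`: either `f` is regular at `z` and its
derivative vanishes there, or `z` is a multiple pole. -/
def IsCriticalPoint (f : ℂ → ℂ) (z : ℂ) : Prop :=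
  (0 ≤ meromorphicOrderAt f z ∧ 0 < meromorphicOrderAt (deriv f) z) ∨
    meromorphicOrderAt f z ≤ (-2 : ℤ)

/-- Critical values are the images, in the Riemann sphere, of critical points. -/
def IsCriticalValue (f : ℂ → ℂ) (a : OnePoint ℂ) : Prop :=
  ∃ z : ℂ, IsCriticalPoint f z ∧ sphereMap f z = a

/-- `a` is an asymptotic value of `f`: there is a curve in the plane tending to infinity along which
`f` tends to `a` in the Riemann sphere. -/
def IsAsymptoticValue (f : ℂ → ℂ) (a : OnePoint ℂ) : Prop :=
  ∃ γ : ℝ → ℂ, ContinuousOn γ (Set.Ici 0) ∧ Tendsto γ atTop (cocompact ℂ) ∧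
    Tendsto (fun t => sphereMap f (γ t)) atTop (𝓝 a)

/-- The set of singular values in the Riemann sphere. -/
def singularValues (f : ℂ → ℂ) : Set (OnePoint ℂ) :=
  {a | IsCriticalValue f a ∨ IsAsymptoticValue f a}

/-- `f` is, as a meromorphic function (that is, off a closed discrete set), a rational function. -/
def IsRational (f : ℂ → ℂ) : Prop :=
  ∃ p q : Polynomial ℂ, q ≠ 0 ∧ f =ᶠ[codiscrete ℂ] fun z => p.eval z / q.eval z

/-- Transcendental meromorphic functions in the plane. -/
def IsTranscendentalMeromorphic (f : ℂ → ℂ) : Prop :=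
  Meromorphic f ∧ ¬ IsRational f

/-- The lower limit of `T(r, f) / √r` as `r → ∞`, in the extended reals, where `T(r, f)` is the
Nevanlinna characteristic. -/
noncomputable def lowerGrowth (f : ℂ → ℂ) : EReal :=
  liminf (fun r : ℝ => ((ValueDistribution.characteristic f ⊤ r / Real.sqrt r : ℝ) : EReal)) atTop

end SingularValues

/-! A finite asymptotic value a is moved to ∞ by passing from f to F = 1/(f - a), which changes the
characteristic by O(1). For large L the set exp L < |w| < ∞ contains no singular value, so paths
there lift through F, and `log F` has inverse branches ψ on the half plane Re ζ > L
(`UnramifiedAbove.exists_isLogInverse`). Such a branch is injective or has an imaginary period. If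
it is periodic, the tract ψ(Re ζ > L') either fills a neighbourhood of ∞, and then F is rational, or
becomes a bounded neighbourhood of a pole once the pole is added, and then the asymptotic curve
could not escape from it. Hence the branch met by the asymptotic curve is injective
(`IsLogInverse.injOn`).

A univalent function on a half plane whose values omit a disc grows at most quadratically, so |ψ(L'
+ x)| ≤ C(1 + x)². Thus log|F| is at least of order √r at some point of modulus r/2. Since log|F| -
L' on the tract, extended by zero, is subharmonic and nonnegative, its value at that point is at
most three times its mean over |z| = r, hence at most 3 m(r, F) ≤ 3 T(r, F).

The growth theorem comes from logarithmic area: if f is injective with d < |f| < M, then f'/f has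
square norm at most 2π log(M/d). Pairing it with a Bergman kernel bounds log|f(z)/f(0)| by half of
log(M/d) plus an explicit term. Because M enters only with exponent 1/2, the maximum of (R -
|z|)²|f(z)| is controlled by its own square root.

For an entire function no curve need be given: ψ along a horizontal ray is an asymptotic curve for
∞. -/

section
open Filter Topology MeasureTheory Set
open scoped ComplexConjugate Real

/-! ### Logarithmic area, Bergman kernel and the growth theorem for univalent functions -/

namespace SingularValues

/-- Integration over an annulus in polar coordinates. -/
theorem setIntegral_annulus_eq {E : Type*} [NormedAddCommGroup E] [NormedSpace ℝ E]
    {φ : ℂ → E} {a b : ℝ} (ha : 0 ≤ a) (hab : a ≤ b)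
    (hφ : ContinuousOn φ {z | ‖z‖ ∈ Icc a b}) :
    ∫ z in {z : ℂ | ‖z‖ ∈ Ioo a b}, φ z =
      ∫ ρ in a..b, (2 * π * ρ) • Real.circleAverage φ 0 ρ := by
  have hpol : ∀ p : ℝ × ℝ, Complex.polarCoord.symm p = circleMap 0 p.1 p.2 := by
    intro p
    simp [Complex.polarCoord_symm_apply, circleMap, Complex.exp_mul_I]
  have hm : MeasurableSet {z : ℂ | ‖z‖ ∈ Ioo a b} := measurableSet_Ioo.preimage measurable_norm
  rw [← integral_indicator hm, ← Complex.integral_comp_polarCoord_symm]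
  have hcm : Continuous fun p : ℝ × ℝ => circleMap 0 p.1 p.2 := by
    unfold circleMap
    fun_prop
  have hcont : ContinuousOn (fun p : ℝ × ℝ => p.1 • φ (circleMap 0 p.1 p.2))
      (Icc a b ×ˢ Icc (-π) π) := by
    refine continuous_fst.continuousOn.smul (hφ.comp hcm.continuousOn ?_)
    rintro ⟨ρ, θ⟩ ⟨h1, -⟩
    simp only [mem_ofPred_eq, norm_circleMap_zero]
    rwa [abs_of_nonneg (ha.trans h1.1)]
  have hint : IntegrableOn (fun p : ℝ × ℝ => p.1 • φ (circleMap 0 p.1 p.2))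
      (Ioo a b ×ˢ Ioo (-π) π) :=
    (hcont.integrableOn_compact (isCompact_Icc.prod isCompact_Icc)).mono_set
      (prod_mono Ioo_subset_Icc_self Ioo_subset_Icc_self)
  have hms : MeasurableSet (Ioo a b ×ˢ Ioo (-π) π) := measurableSet_Ioo.prod measurableSet_Ioo
  have h1 : ∫ p in polarCoord.target, p.1 • ({z : ℂ | ‖z‖ ∈ Ioo a b}.indicator φ)
      (Complex.polarCoord.symm p) =
      ∫ p in Ioo a b ×ˢ Ioo (-π) π, p.1 • φ (circleMap 0 p.1 p.2) := by
    rw [← integral_indicator hms, ← integral_indicator polarCoord.open_target.measurableSet]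
    congr 1
    ext ⟨ρ, θ⟩
    simp only [indicator, polarCoord_target, mem_prod, hpol, mem_ofPred_eq, norm_circleMap_zero]
    by_cases hρ : 0 < ρ
    · rw [abs_of_pos hρ]
      simp only [mem_Ioi, hρ, true_and]
      split_ifs <;> simp_all
    · have : ρ ∉ Ioo a b := fun h => hρ (ha.trans_lt h.1)
      simp [hρ, this]
  rw [h1, Measure.volume_eq_prod, setIntegral_prod _ (by rwa [← Measure.volume_eq_prod]),
    intervalIntegral.integral_of_le hab, integral_Ioc_eq_integral_Ioo]
  refine setIntegral_congr_fun measurableSet_Ioo fun ρ _ => ?_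
  simp only
  rw [integral_smul, Real.circleAverage_def, smul_smul, mul_comm (2 * π) ρ, mul_assoc,
    mul_inv_cancel₀ (by positivity), mul_one, ← integral_Ioc_eq_integral_Ioo,
    ← intervalIntegral.integral_of_le (by linarith [Real.pi_pos])]
  congr 1
  have := (periodic_circleMap 0 ρ).comp φ
  have h2 := this.intervalIntegral_add_eq (-π) 0
  simp only [Function.comp_apply, zero_add] at h2
  rw [← h2]; congr 1; ring

theorem det_restrictScalars_smul_one (c : ℂ) :
    ((c • (1 : ℂ →L[ℂ] ℂ)).restrictScalars ℝ).det = ‖c‖ ^ 2 := by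
  have : (((c • (1 : ℂ →L[ℂ] ℂ)).restrictScalars ℝ : ℂ →L[ℝ] ℂ) : ℂ →ₗ[ℝ] ℂ) =
      (c • (1 : ℂ →ₗ[ℂ] ℂ)).restrictScalars ℝ := rfl
  rw [ContinuousLinearMap.det, this, LinearMap.det_restrictScalars]
  simp [Algebra.norm_complex_apply, Complex.normSq_eq_norm_sq]

/-- The logarithmic area of the image of an injective function. -/
theorem setIntegral_norm_deriv_div_sq_le {f : ℂ → ℂ} {s : Set ℂ} (hs : MeasurableSet s)
    {d M : ℝ} (hd : 0 < d) (hdM : d ≤ M)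
    (hf : ∀ z ∈ s, DifferentiableAt ℂ f z) (hinj : InjOn f s)
    (hfd : ∀ z ∈ s, d < ‖f z‖) (hfM : ∀ z ∈ s, ‖f z‖ < M) :
    ∫ z in s, ‖deriv f z / f z‖ ^ 2 ≤ 2 * π * Real.log (M / d) := by
  have hcv := integral_image_eq_integral_abs_det_fderiv_smul volume hs
    (f := f) (f' := fun z => (deriv f z • (1 : ℂ →L[ℂ] ℂ)).restrictScalars ℝ)
    (fun z hz => by
      have h := (hf z hz).hasDerivAt.hasFDerivAt.restrictScalars ℝ
      have h2 : ContinuousLinearMap.toSpanSingleton ℂ (deriv f z) =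
        deriv f z • (1 : ℂ →L[ℂ] ℂ) := by ext; simp
      rw [h2] at h
      exact h.hasFDerivWithinAt) hinj (fun w => (‖w‖ ^ 2)⁻¹)
  -- The real Jacobian of f is |f'|², so by injectivity this is the integral of |w|⁻² over the
  -- image, which lies in the annulus d < |w| < M.
  have h1 : ∫ z in s, ‖deriv f z / f z‖ ^ 2 = ∫ w in f '' s, (‖w‖ ^ 2)⁻¹ := by
    rw [hcv]
    refine setIntegral_congr_fun hs fun z _ => ?_
    simp only [det_restrictScalars_smul_one, smul_eq_mul]
    rw [abs_of_nonneg (by positivity), norm_div, div_pow, div_eq_mul_inv]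
  have hc : ContinuousOn (fun w : ℂ => (‖w‖ ^ 2)⁻¹) {z | ‖z‖ ∈ Icc d M} := by
    refine ContinuousOn.inv₀ (by fun_prop) fun w hw => ?_
    have : 0 < ‖w‖ := hd.trans_le hw.1
    positivity
  have hcomp : IsCompact {z : ℂ | ‖z‖ ∈ Icc d M} := by
    refine (isCompact_closedBall (0 : ℂ) M).of_isClosed_subset
      (isClosed_Icc.preimage continuous_norm) fun z hz => ?_
    simpa using hz.2
  rw [h1]
  calc ∫ w in f '' s, (‖w‖ ^ 2)⁻¹
      ≤ ∫ w in {z : ℂ | ‖z‖ ∈ Ioo d M}, (‖w‖ ^ 2)⁻¹ := by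
        refine setIntegral_mono_set ((hc.integrableOn_compact hcomp).mono_set
          fun z hz => Ioo_subset_Icc_self hz) ?_ ?_
        · exact Eventually.of_forall fun w => by simp only [Pi.zero_apply]; positivity
        · refine LE.le.eventuallyLE ?_
          rintro _ ⟨z, hz, rfl⟩
          exact ⟨hfd z hz, hfM z hz⟩
    _ = ∫ ρ in d..M, (2 * π) * (1 / ρ) := by
        rw [setIntegral_annulus_eq hd.le hdM hc]
        refine intervalIntegral.integral_congr fun ρ hρ => ?_
        rw [uIcc_of_le hdM] at hρ
        have hρ0 : 0 < ρ := hd.trans_le hρ.1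
        rw [Real.circleAverage_const_on_circle (a := (ρ ^ 2)⁻¹)]
        · simp only [smul_eq_mul]
          field_simp
        · intro x hx
          have : ‖x‖ = ρ := by simpa [abs_of_pos hρ0] using hx
          rw [this]
    _ = 2 * π * Real.log (M / d) := by
        rw [intervalIntegral.integral_const_mul, integral_one_div_of_pos hd (hd.trans_le hdM)]

/-- The reproducing formula for primitives in the Bergman space of a disc. -/
theorem setIntegral_deriv_mul_kernel {q : ℂ → ℂ} {r R : ℝ} (hr : 0 < r) (hrR : r < R)
    (hq : DifferentiableOn ℂ q (Metric.ball 0 R)) {z : ℂ} (hz : ‖z‖ < r) :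
    ∫ w in {w : ℂ | ‖w‖ ∈ Ioo 0 r}, deriv q w * (z / (r ^ 2 - z * conj w)) =
      π * (q z - q 0) := by
  have hden : ∀ w : ℂ, ‖w‖ ≤ r → (r : ℂ) ^ 2 - z * conj w ≠ 0 := by
    intro w hw h
    have h1 : ‖(r : ℂ) ^ 2‖ = ‖z * conj w‖ := by rw [sub_eq_zero.mp h]
    rw [norm_mul, RCLike.norm_conj, norm_pow, Complex.norm_real, Real.norm_of_nonneg hr.le] at h1
    nlinarith [norm_nonneg z, norm_nonneg w]
  have hq' : DifferentiableOn ℂ (deriv q) (Metric.ball 0 R) := hq.deriv Metric.isOpen_ball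
  have hsub : ∀ w : ℂ, ‖w‖ ≤ r → w ∈ Metric.ball (0 : ℂ) R := fun w hw => by
    simpa using hw.trans_lt hrR
  have hcont : ContinuousOn (fun w => deriv q w * (z / (r ^ 2 - z * conj w)))
      {w : ℂ | ‖w‖ ∈ Icc 0 r} := by
    refine (hq'.continuousOn.mono fun w hw => hsub w hw.2).mul ?_
    exact continuousOn_const.div (by fun_prop) fun w hw => hden w hw.2
  have hmem : ∀ ρ ∈ Icc 0 r, ‖z * (ρ : ℂ) ^ 2 / (r : ℂ) ^ 2‖ ≤ ρ := by
    intro ρ hρ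
    rw [norm_div, norm_mul, norm_pow, norm_pow, Complex.norm_real, Complex.norm_real,
      Real.norm_of_nonneg hr.le, Real.norm_of_nonneg hρ.1, div_le_iff₀ (by positivity)]
    have := mul_le_mul hz.le hρ.2 hρ.1 hr.le
    nlinarith [hρ.1]
  rw [setIntegral_annulus_eq le_rfl hr.le hcont]
  -- On |w| = ρ one has conj w = ρ²/w, which turns the kernel into a Cauchy kernel with its pole a =
  -- zρ²/r² inside the circle.
  have havg : ∀ ρ ∈ Ioo 0 r, Real.circleAverage
      (fun w => deriv q w * (z / (r ^ 2 - z * conj w))) 0 ρ =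
      z / r ^ 2 * deriv q (z * ρ ^ 2 / r ^ 2) := by
    intro ρ hρ
    have hρ0 : (ρ : ℂ) ≠ 0 := by exact_mod_cast hρ.1.ne'
    have hr0 : (r : ℂ) ≠ 0 := by exact_mod_cast hr.ne'
    set a : ℂ := z * ρ ^ 2 / r ^ 2 with ha
    have hlt : a ∈ Metric.ball (0 : ℂ) ρ := by
      rw [mem_ball_zero_iff, ha, norm_div, norm_mul, norm_pow, norm_pow, Complex.norm_real,
        Complex.norm_real, Real.norm_of_nonneg hr.le, Real.norm_of_nonneg hρ.1.le,
        div_lt_iff₀ (by positivity)]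
      have : ‖z‖ * ρ < r * r := by
        have := norm_nonneg z
        nlinarith [hρ.1, hρ.2]
      nlinarith [hρ.1]
    have hC := Complex.circleIntegral_sub_inv_smul_of_differentiable_on_off_countable
      (f := deriv q) countable_empty hlt
      (hq'.continuousOn.mono fun w hw => hsub w ((mem_closedBall_zero_iff.mp hw).trans hρ.2.le))
      (fun x hx => hq'.differentiableAt (Metric.isOpen_ball.mem_nhds
        (hsub x ((mem_ball_zero_iff.mp hx.1).le.trans hρ.2.le))))
    rw [Real.circleAverage_eq_circleIntegral hρ.1.ne']
    have : ∮ w in C(0, ρ), (w - 0)⁻¹ • (deriv q w * (z / (r ^ 2 - z * conj w))) =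
        ∮ w in C(0, ρ), (z / r ^ 2) • ((w - a)⁻¹ • deriv q w) := by
      refine circleIntegral.integral_congr hρ.1.le fun w hw => ?_
      have hwρ : ‖w‖ = ρ := by simpa using hw
      have hw0 : w ≠ 0 := by
        rw [← norm_pos_iff, hwρ]; exact hρ.1
      have hconj : conj w = ρ ^ 2 / w := by
        rw [eq_div_iff hw0, mul_comm, Complex.mul_conj, Complex.normSq_eq_norm_sq, hwρ]
        push_cast; ring
      have h1 := hden w (hwρ.le.trans hρ.2.le)
      rw [hconj] at h1
      have h2 : w - a ≠ 0 := by
        intro h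
        have := mem_ball_zero_iff.mp hlt
        rw [← sub_eq_zero.mp h, hwρ] at this
        exact lt_irrefl _ this
      have h3 : (r : ℂ) ^ 2 - z * (ρ ^ 2 / w) = r ^ 2 / w * (w - a) := by
        rw [ha]; field_simp
      simp only [smul_eq_mul, sub_zero]
      rw [hconj, h3]
      field_simp
    rw [this, circleIntegral.integral_smul, hC]
    simp only [smul_eq_mul]
    field_simp
  -- With the polar factor 2πρ the circle averages form an exact derivative in ρ.
  have hderiv : ∀ ρ ∈ uIcc 0 r, HasDerivAt (fun ρ : ℝ => (π : ℂ) * q (z * ρ ^ 2 / r ^ 2))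
      ((2 * π * ρ) • (z / r ^ 2 * deriv q (z * ρ ^ 2 / r ^ 2))) ρ := by
    intro ρ hρ
    rw [uIcc_of_le hr.le] at hρ
    have h1 : HasDerivAt q (deriv q (z * ρ ^ 2 / r ^ 2)) (z * ρ ^ 2 / r ^ 2) :=
      (hq.differentiableAt (Metric.isOpen_ball.mem_nhds
        (hsub _ ((hmem ρ hρ).trans hρ.2)))).hasDerivAt
    have h2 : HasDerivAt (fun ρ : ℝ => z * (ρ : ℂ) ^ 2 / r ^ 2) (z * (2 * ρ) / r ^ 2) ρ := by
      have := (((Complex.ofRealCLM.hasDerivAt (x := ρ)).pow 2).const_mul z).div_const ((r : ℂ) ^ 2)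
      simpa using this
    have h3 := (h1.scomp ρ h2).const_mul (π : ℂ)
    have h4 : (2 * π * ρ) • (z / r ^ 2 * deriv q (z * ρ ^ 2 / r ^ 2)) =
        (π : ℂ) * (z * (2 * ρ) / r ^ 2) • deriv q (z * ρ ^ 2 / r ^ 2) := by
      rw [Complex.real_smul, smul_eq_mul]
      push_cast
      ring
    rw [h4]
    exact h3
  have hcont2 : ContinuousOn (fun ρ : ℝ =>
      (2 * π * ρ) • (z / r ^ 2 * deriv q (z * ρ ^ 2 / r ^ 2))) (uIcc 0 r) := by
    rw [uIcc_of_le hr.le]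
    refine (show Continuous fun ρ : ℝ => 2 * π * ρ by fun_prop).continuousOn.smul
      (continuousOn_const.mul ?_)
    exact hq'.continuousOn.comp (f := fun ρ : ℝ => z * (ρ : ℂ) ^ 2 / (r : ℂ) ^ 2)
      (by fun_prop) fun ρ hρ => hsub _ ((hmem ρ hρ).trans hρ.2)
  have hr0 : (r : ℂ) ≠ 0 := by exact_mod_cast hr.ne'
  calc _ = ∫ ρ in (0 : ℝ)..r, (2 * π * ρ) • (z / r ^ 2 * deriv q (z * ρ ^ 2 / r ^ 2)) := by
        rw [intervalIntegral.integral_of_le hr.le, intervalIntegral.integral_of_le hr.le,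
          integral_Ioc_eq_integral_Ioo, integral_Ioc_eq_integral_Ioo]
        exact setIntegral_congr_fun measurableSet_Ioo fun ρ hρ => by simp only [havg ρ hρ]
    _ = _ := by
        rw [intervalIntegral.integral_eq_sub_of_hasDerivAt hderiv hcont2.intervalIntegrable]
        rw [mul_div_assoc, div_self (pow_ne_zero 2 hr0)]
        simp
        ring

/-- The norm of the reproducing kernel. -/
theorem setIntegral_norm_kernel_sq {r : ℝ} (hr : 0 < r) {z : ℂ} (hz : ‖z‖ < r) :
    ∫ w in {w : ℂ | ‖w‖ ∈ Ioo 0 r}, ‖z / (r ^ 2 - z * conj w)‖ ^ 2 =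
      -(π * Real.log (1 - ‖z‖ ^ 2 / r ^ 2)) := by
  -- The condition |z|R < r² makes log(1 - conj z · w/r²) holomorphic on |w| < R. Its negative has
  -- the conjugate kernel as derivative, so the reproducing formula for it computes the norm.
  obtain ⟨R, hrR, hR⟩ : ∃ R, r < R ∧ ‖z‖ * R < r ^ 2 := by
    rcases (norm_nonneg z).eq_or_lt with h | h
    · exact ⟨r + 1, by linarith, by rw [← h]; simp; positivity⟩
    · refine ⟨(r + r ^ 2 / ‖z‖) / 2, ?_, ?_⟩
      · have : r < r ^ 2 / ‖z‖ := by rw [lt_div_iff₀ h]; nlinarith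
        linarith
      · have h1 : ‖z‖ * ((r + r ^ 2 / ‖z‖) / 2) = (‖z‖ * r + r ^ 2) / 2 := by
          field_simp
        rw [h1]
        nlinarith
  have hr0 : (r : ℂ) ≠ 0 := by exact_mod_cast hr.ne'
  have hlt : ∀ w : ℂ, ‖w‖ < R → ‖conj z * w / r ^ 2‖ < 1 := by
    intro w hw
    rw [norm_div, norm_mul, RCLike.norm_conj, norm_pow, Complex.norm_real,
      Real.norm_of_nonneg hr.le, div_lt_one (by positivity)]
    exact (mul_le_mul_of_nonneg_left hw.le (norm_nonneg z)).trans_lt hR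
  have hslit : ∀ w : ℂ, ‖w‖ < R → 1 - conj z * w / r ^ 2 ∈ Complex.slitPlane := by
    intro w hw
    refine Or.inl ?_
    have := (Complex.re_le_norm (conj z * w / r ^ 2)).trans_lt (hlt w hw)
    simp only [Complex.sub_re, Complex.one_re]
    linarith
  have hder : ∀ w : ℂ, ‖w‖ < R → HasDerivAt (fun w => -Complex.log (1 - conj z * w / r ^ 2))
      (conj (z / (r ^ 2 - z * conj w))) w := by
    intro w hw
    have h1 : HasDerivAt (fun w => 1 - conj z * w / r ^ 2) (-(conj z / r ^ 2)) w := by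
      have := (((hasDerivAt_id w).const_mul (conj z)).div_const ((r : ℂ) ^ 2)).const_sub 1
      simpa using this
    have h2 := (h1.clog (hslit w hw)).neg
    have h3 : conj (z / (r ^ 2 - z * conj w)) =
        -(-(conj z / r ^ 2) / (1 - conj z * w / r ^ 2)) := by
      have h4 := Complex.slitPlane_ne_zero (hslit w hw)
      have h5 : (r : ℂ) ^ 2 - conj z * w = r ^ 2 * (1 - conj z * w / r ^ 2) := by
        field_simp
      simp only [map_div₀, map_sub, map_pow, map_mul, Complex.conj_ofReal, Complex.conj_conj]
      rw [h5]
      field_simp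
    rw [h3]
    exact h2
  have hmain := setIntegral_deriv_mul_kernel (q := fun w => -Complex.log (1 - conj z * w / r ^ 2))
    hr hrR (fun w hw => (hder w (mem_ball_zero_iff.mp hw)).differentiableAt.differentiableWithinAt)
    hz
  have hm : MeasurableSet {w : ℂ | ‖w‖ ∈ Ioo 0 r} := measurableSet_Ioo.preimage measurable_norm
  have h1 : ∫ w in {w : ℂ | ‖w‖ ∈ Ioo 0 r},
      deriv (fun w => -Complex.log (1 - conj z * w / r ^ 2)) w * (z / (r ^ 2 - z * conj w)) =
      ((∫ w in {w : ℂ | ‖w‖ ∈ Ioo 0 r}, ‖z / (r ^ 2 - z * conj w)‖ ^ 2 : ℝ) : ℂ) := by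
    rw [← integral_complex_ofReal]
    refine setIntegral_congr_fun hm fun w hw => ?_
    rw [(hder w (hw.2.trans hrR)).deriv, mul_comm, Complex.mul_conj, Complex.normSq_eq_norm_sq]
  rw [h1] at hmain
  have h2 : conj z * z / (r : ℂ) ^ 2 = ((‖z‖ ^ 2 / r ^ 2 : ℝ) : ℂ) := by
    rw [mul_comm, Complex.mul_conj, Complex.normSq_eq_norm_sq]
    push_cast; rfl
  have h3 : (0 : ℝ) ≤ 1 - ‖z‖ ^ 2 / r ^ 2 := by
    rw [sub_nonneg, div_le_one (by positivity)]
    exact pow_le_pow_left₀ (norm_nonneg z) hz.le 2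
  rw [h2, ← Complex.ofReal_one, ← Complex.ofReal_sub, ← Complex.ofReal_log h3] at hmain
  have h4 := congrArg Complex.re hmain
  simpa using h4

/-- A nonvanishing holomorphic function on a disc has a holomorphic logarithm. -/
theorem exists_log_on_ball {f : ℂ → ℂ} {R : ℝ} (hf : DifferentiableOn ℂ f (Metric.ball 0 R))
    (h0 : ∀ z ∈ Metric.ball (0 : ℂ) R, f z ≠ 0) :
    ∃ q : ℂ → ℂ, (∀ z ∈ Metric.ball (0 : ℂ) R, HasDerivAt q (deriv f z / f z) z) ∧
      ∀ z ∈ Metric.ball (0 : ℂ) R, f z = f 0 * Complex.exp (q z - q 0) := by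
  obtain ⟨q, hq⟩ := ((hf.deriv Metric.isOpen_ball).div hf h0).isExactOn_ball
  refine ⟨q, hq, fun z hz => ?_⟩
  have hR : 0 < R := (norm_nonneg z).trans_lt (mem_ball_zero_iff.mp hz)
  have hder : ∀ z ∈ Metric.ball (0 : ℂ) R,
      HasDerivAt (fun z => f z * Complex.exp (-q z)) 0 z := by
    intro w hw
    have h1 := (hf.differentiableAt (Metric.isOpen_ball.mem_nhds hw)).hasDerivAt
    have h2 := h1.mul ((hq w hw).neg.cexp)
    have h3 : deriv f w * Complex.exp (-q w) + f w * (Complex.exp (-q w) * -(deriv f w / f w)) =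
        0 := by
      have := h0 w hw
      field_simp
      ring
    rw [← h3]
    exact h2
  have hconst := (convex_ball (0 : ℂ) R).is_const_of_fderivWithin_eq_zero (𝕜 := ℂ)
    (f := fun z => f z * Complex.exp (-q z))
    (fun w hw => (hder w hw).differentiableAt.differentiableWithinAt)
    (fun w hw => by
      rw [fderivWithin_of_isOpen Metric.isOpen_ball hw, (hder w hw).hasFDerivAt.fderiv]
      ext; simp) hz (Metric.mem_ball_self hR)
  simp only [Complex.exp_neg] at hconst
  have e1 := Complex.exp_ne_zero (q z)
  have e2 := Complex.exp_ne_zero (q 0)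
  rw [Complex.exp_sub]
  field_simp at hconst ⊢
  linear_combination hconst

/-- With q = log f, the difference q(z) - q(0) is the pairing of f'/f with the kernel. The
inequality ab ≤ a²/4 + b² then separates the logarithmic area from the kernel norm; the weight 1/4
is what leaves the factor 1/2 on log(M/d). -/
theorem log_norm_div_le_of_injOn {f : ℂ → ℂ} {r R d M : ℝ} (hr : 0 < r) (hrR : r < R)
    (hf : DifferentiableOn ℂ f (Metric.ball 0 R)) (hinj : InjOn f (Metric.ball 0 R))
    (hd : 0 < d) (hfd : ∀ z ∈ Metric.ball (0 : ℂ) R, d < ‖f z‖)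
    (hfM : ∀ z ∈ Metric.ball (0 : ℂ) r, ‖f z‖ < M) {z : ℂ} (hz : ‖z‖ < r) :
    Real.log (‖f z‖ / ‖f 0‖) ≤ Real.log (M / d) / 2 - Real.log (1 - ‖z‖ ^ 2 / r ^ 2) := by
  have h0 : ∀ z ∈ Metric.ball (0 : ℂ) R, f z ≠ 0 := fun z hz h => by
    have := hfd z hz
    rw [h, norm_zero] at this
    linarith
  obtain ⟨q, hq, hfq⟩ := exists_log_on_ball hf h0
  have hsub : Metric.ball (0 : ℂ) r ⊆ Metric.ball 0 R := Metric.ball_subset_ball hrR.le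
  have hzR : z ∈ Metric.ball (0 : ℂ) R := hsub (mem_ball_zero_iff.mpr hz)
  have hlog : Real.log (‖f z‖ / ‖f 0‖) = (q z - q 0).re := by
    rw [hfq z hzR, norm_mul, mul_div_cancel_left₀, Complex.norm_exp, Real.log_exp]
    exact norm_ne_zero_iff.mpr (h0 0 (Metric.mem_ball_self (hr.trans hrR)))
  set A : Set ℂ := {w : ℂ | ‖w‖ ∈ Ioo 0 r} with hA
  have hAball : A ⊆ Metric.ball 0 r := fun w hw => mem_ball_zero_iff.mpr hw.2
  have hm : MeasurableSet A := measurableSet_Ioo.preimage measurable_norm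
  have hrep := setIntegral_deriv_mul_kernel hr hrR
    (fun w hw => (hq w hw).differentiableAt.differentiableWithinAt) hz
  have harea := setIntegral_norm_deriv_div_sq_le hm hd
    ((hfd z hzR).le.trans (hfM z (mem_ball_zero_iff.mpr hz)).le)
    (fun w hw => hf.differentiableAt (Metric.isOpen_ball.mem_nhds (hsub (hAball hw))))
    (hinj.mono (hAball.trans hsub)) (fun w hw => hfd w (hsub (hAball hw)))
    (fun w hw => hfM w (hAball hw))
  have hker := setIntegral_norm_kernel_sq hr hz
  have hK : IsCompact (Metric.closedBall (0 : ℂ) r) := isCompact_closedBall 0 r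
  have hKR : Metric.closedBall (0 : ℂ) r ⊆ Metric.ball 0 R := Metric.closedBall_subset_ball hrR
  have hAK : A ⊆ Metric.closedBall 0 r := hAball.trans Metric.ball_subset_closedBall
  have hden : ∀ w ∈ Metric.closedBall (0 : ℂ) r, (r : ℂ) ^ 2 - z * conj w ≠ 0 := by
    intro w hw h
    rw [mem_closedBall_zero_iff] at hw
    have h1 : ‖(r : ℂ) ^ 2‖ = ‖z * conj w‖ := by rw [sub_eq_zero.mp h]
    rw [norm_mul, RCLike.norm_conj, norm_pow, Complex.norm_real, Real.norm_of_nonneg hr.le] at h1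
    nlinarith [norm_nonneg z, norm_nonneg w]
  have hc1 : ContinuousOn (fun w => deriv f w / f w) (Metric.closedBall 0 r) :=
    ((hf.deriv Metric.isOpen_ball).div hf h0).continuousOn.mono hKR
  have hc2 : ContinuousOn (fun w : ℂ => z / (r ^ 2 - z * conj w)) (Metric.closedBall 0 r) :=
    continuousOn_const.div (by fun_prop) hden
  have hi1 : IntegrableOn (fun w => ‖deriv f w / f w‖ ^ 2) A :=
    ((hc1.norm.pow 2).integrableOn_compact hK).mono_set hAK
  have hi2 : IntegrableOn (fun w : ℂ => ‖z / (r ^ 2 - z * conj w)‖ ^ 2) A :=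
    ((hc2.norm.pow 2).integrableOn_compact hK).mono_set hAK
  have hle : π * (q z - q 0).re ≤
      ∫ w in A, (‖deriv f w / f w‖ ^ 2 / 4 + ‖z / (r ^ 2 - z * conj w)‖ ^ 2) := by
    calc π * (q z - q 0).re = (π * (q z - q 0)).re := by simp
      _ ≤ ‖(π * (q z - q 0) : ℂ)‖ := Complex.re_le_norm _
      _ ≤ _ := by
        rw [← hrep]
        refine norm_integral_le_of_norm_le ((hi1.div_const 4).add hi2) ?_
        refine (ae_restrict_iff' hm).mpr (Eventually.of_forall fun w hw => ?_)
        rw [(hq w (hsub (hAball hw))).deriv, norm_mul]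
        nlinarith [sq_nonneg (‖deriv f w / f w‖ / 2 - ‖z / ((r : ℂ) ^ 2 - z * conj w)‖)]
  rw [integral_add (hi1.div_const 4) hi2, integral_div, hker] at hle
  rw [hlog]
  have hpi := Real.pi_pos
  have : π * (q z - q 0).re ≤ π * (Real.log (M / d) / 2 - Real.log (1 - ‖z‖ ^ 2 / r ^ 2)) := by
    linarith
  exact le_of_mul_le_mul_left this hpi

/-- **Growth theorem** for injective holomorphic functions on the disc whose values stay away from
zero, with the sharp exponent. -/
theorem norm_le_of_injOn_ball {f : ℂ → ℂ} (hf : DifferentiableOn ℂ f (Metric.ball 0 1))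
    (hinj : InjOn f (Metric.ball 0 1)) {d : ℝ} (hd : 0 < d)
    (hfd : ∀ z ∈ Metric.ball (0 : ℂ) 1, d < ‖f z‖) {z : ℂ} (hz : ‖z‖ < 1) :
    ‖f z‖ ≤ 32 * ‖f 0‖ ^ 2 / d / (1 - ‖z‖) ^ 2 := by
  -- The maximum is taken over |z| ≤ R with R < 1, where f is continuous on a compact set; R → 1 at
  -- the end.
  have key : ∀ R : ℝ, 0 < R → R < 1 → ∀ z : ℂ, ‖z‖ ≤ R →
      (R - ‖z‖) ^ 2 * ‖f z‖ ≤ 32 * ‖f 0‖ ^ 2 / d := by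
    intro R hR hR1 z hz
    have hcR : Metric.closedBall (0 : ℂ) R ⊆ Metric.ball 0 1 := Metric.closedBall_subset_ball hR1
    have hcont : ContinuousOn (fun z => (R - ‖z‖) ^ 2 * ‖f z‖) (Metric.closedBall 0 R) :=
      (by fun_prop : Continuous fun z : ℂ => (R - ‖z‖) ^ 2).continuousOn.mul
        (hf.continuousOn.mono hcR).norm
    obtain ⟨z₀, hz₀, hmax⟩ := (isCompact_closedBall (0 : ℂ) R).exists_isMaxOn
      ⟨0, Metric.mem_closedBall_self hR.le⟩ hcont
    set K := (R - ‖z₀‖) ^ 2 * ‖f z₀‖ with hK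
    have hKle : ∀ w : ℂ, ‖w‖ ≤ R → (R - ‖w‖) ^ 2 * ‖f w‖ ≤ K := fun w hw =>
      hmax (mem_closedBall_zero_iff.mpr hw)
    refine (hKle z hz).trans ?_
    have hf0 : d < ‖f 0‖ := hfd 0 (Metric.mem_ball_self one_pos)
    have hKpos : 0 < K := by
      have h1 := hKle 0 (by simpa using hR.le)
      have h2 : 0 < ‖f 0‖ := hd.trans hf0
      have : 0 < (R - ‖(0 : ℂ)‖) ^ 2 * ‖f 0‖ := by
        rw [norm_zero, sub_zero]; positivity
      linarith
    have hs : ‖z₀‖ < R := by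
      refine lt_of_le_of_ne (mem_closedBall_zero_iff.mp hz₀) fun h => ?_
      rw [hK, h] at hKpos
      simp at hKpos
    set s := ‖z₀‖ with hsdef
    have hs0 : 0 ≤ s := norm_nonneg _
    set r := (s + R) / 2 with hr
    have hrR : r < R := by linarith
    have hsr : s < r := by linarith
    have hr0 : 0 < r := by linarith
    -- Here R - |w| ≥ (R - s)/2, so maximality of K gives |f w| ≤ 4K/(R - s)²; the 8 makes the
    -- inequality strict.
    have hM : ∀ w ∈ Metric.ball (0 : ℂ) r, ‖f w‖ < 8 * K / (R - s) ^ 2 := by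
      intro w hw
      have hw' : ‖w‖ < r := mem_ball_zero_iff.mp hw
      have h1 := hKle w (hw'.le.trans hrR.le)
      have h2 : (R - s) / 2 ≤ R - ‖w‖ := by linarith
      have h3 : ((R - s) / 2) ^ 2 ≤ (R - ‖w‖) ^ 2 := pow_le_pow_left₀ (by linarith) h2 2
      have h4 := mul_le_mul_of_nonneg_right h3 (norm_nonneg (f w))
      rw [lt_div_iff₀ (by nlinarith)]
      nlinarith
    have hlog := log_norm_div_le_of_injOn hr0 (hrR.trans hR1) hf hinj hd hfd hM hsr
    have hf0pos : 0 < ‖f 0‖ := hd.trans hf0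
    have hfz : 0 < ‖f z₀‖ := hd.trans (hfd z₀ (hcR hz₀))
    have hq : (R - s) / 2 ≤ 1 - s ^ 2 / r ^ 2 := by
      rw [le_sub_iff_add_le, ← le_sub_iff_add_le', div_le_iff₀ (by positivity)]
      have h1 : (R - s) / 2 = r - s := by rw [hr]; ring
      rw [h1]
      have : s ^ 2 ≤ s * r := by nlinarith
      have h5 : r < 1 := hrR.trans hR1
      nlinarith [mul_pos (sub_pos.mpr hsr) hr0, mul_nonneg (mul_pos (sub_pos.mpr hsr) hr0).le
        (sub_nonneg.mpr h5.le)]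
    have hlog2 : Real.log ((R - s) / 2) ≤ Real.log (1 - s ^ 2 / r ^ 2) :=
      Real.log_le_log (by linarith) hq
    have hRs : 0 < R - s := by linarith
    have h6 : Real.log (‖f z₀‖ / ‖f 0‖) * 2 + Real.log ((R - s) / 2) * 2 ≤
        Real.log (8 * K / (R - s) ^ 2 / d) := by linarith
    have h7 : Real.log ((‖f z₀‖ / ‖f 0‖) ^ 2 * ((R - s) / 2) ^ 2) ≤
        Real.log (8 * K / (R - s) ^ 2 / d) := by
      rw [Real.log_mul (by positivity) (by positivity), Real.log_pow, Real.log_pow]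
      push_cast
      linarith
    have h8 := (Real.log_le_log_iff (by positivity) (by positivity)).mp h7
    -- After this substitution `h8` is quadratic in K on the left and linear on the right; one
    -- factor K cancels and the constant is 4 · 8 = 32.
    have h9 : ‖f z₀‖ = K / (R - s) ^ 2 := by
      rw [hK]; field_simp
    rw [h9] at h8
    rw [le_div_iff₀ hd]
    field_simp at h8
    nlinarith
  have hlim : Tendsto (fun R : ℝ => (R - ‖z‖) ^ 2 * ‖f z‖) (𝓝[<] 1)
      (𝓝 ((1 - ‖z‖) ^ 2 * ‖f z‖)) := by
    refine Tendsto.mono_left ?_ nhdsWithin_le_nhds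
    exact Continuous.tendsto (by fun_prop) 1
  have hle := le_of_tendsto hlim (by
    filter_upwards [Ioo_mem_nhdsLT (show max ‖z‖ 0 < 1 by simpa using hz)] with R hR
    exact key R ((le_max_right _ _).trans_lt hR.1) hR.2 z ((le_max_left _ _).trans hR.1.le))
  rw [le_div_iff₀ (by have := sub_pos.mpr hz; positivity), mul_comm]
  exact hle

end SingularValues

end

/-! ### Lifting through F and branches of the inverse of log F -/

section
open Filter Topology Set
open scoped Real

namespace SingularValues

/-- `F` is a meromorphic function in normal form which has no singular values in the punctured
neighbourhood `exp L < |w| < ∞` of infinity. -/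
structure UnramifiedAbove (F : ℂ → ℂ) (L : ℝ) : Prop where
  normalForm : ∀ z, MeromorphicNFAt F z
  deriv_ne_zero : ∀ z, Real.exp L < ‖F z‖ → deriv F z ≠ 0
  not_asymptotic : ∀ (w : ℂ) (γ : ℝ → ℂ), Real.exp L < ‖w‖ → ContinuousOn γ (Ici 0) →
    Tendsto γ atTop (cocompact ℂ) → ¬ Tendsto (fun t => F (γ t)) atTop (𝓝 w)

/-- The half plane `Re ζ > L`. -/
def rightHalfPlane (L : ℝ) : Set ℂ := {ζ | L < ζ.re}

theorem isOpen_rightHalfPlane (L : ℝ) : IsOpen (rightHalfPlane L) :=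
  isOpen_lt continuous_const Complex.continuous_re

theorem convex_rightHalfPlane (L : ℝ) : Convex ℝ (rightHalfPlane L) :=
  convex_halfSpace_re_gt L

theorem rightHalfPlane_subset {L L' : ℝ} (h : L ≤ L') : rightHalfPlane L' ⊆ rightHalfPlane L :=
  fun _ hζ => lt_of_le_of_lt h hζ

theorem exp_lt_norm_exp {L : ℝ} {ζ : ℂ} (h : ζ ∈ rightHalfPlane L) :
    Real.exp L < ‖Complex.exp ζ‖ := by
  rw [Complex.norm_exp]
  exact Real.exp_lt_exp.mpr h

/-- `ψ` is a branch on `Re ζ > L` of the inverse of the logarithm of `F`. -/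
structure IsLogInverse (F : ℂ → ℂ) (L : ℝ) (ψ : ℂ → ℂ) : Prop where
  continuousOn : ContinuousOn ψ (rightHalfPlane L)
  map_eq : ∀ ζ ∈ rightHalfPlane L, F (ψ ζ) = Complex.exp ζ

theorem eq_zero_and_tendsto_of_not_analyticAt {F : ℂ → ℂ} {z : ℂ} (hF : MeromorphicNFAt F z)
    (h : ¬ AnalyticAt ℂ F z) : F z = 0 ∧ Tendsto F (𝓝[≠] z) (Bornology.cobounded ℂ) := by
  rcases meromorphicNFAt_iff_analyticAt_or.mp hF with h1 | ⟨h1, h2, h3⟩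
  · exact absurd h1 h
  · exact ⟨h3, (tendsto_cobounded_iff_meromorphicOrderAt_neg h1).mpr h2⟩

theorem exists_mapClusterPt_of_not_tendsto_cocompact {X Y : Type*} [TopologicalSpace Y]
    {l : Filter X} {G : X → Y} (h : ¬ Tendsto G l (cocompact Y)) : ∃ z, MapClusterPt z l G := by
  rw [(hasBasis_cocompact (X := Y)).tendsto_right_iff] at h
  push Not at h
  obtain ⟨K, hK, hfreq⟩ := h
  simp only [mem_compl_iff, not_not] at hfreq
  have : (map G l ⊓ 𝓟 K).NeBot := by
    rw [← frequently_mem_iff_neBot]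
    exact hfreq
  obtain ⟨z, -, hz⟩ := hK.exists_clusterPt (f := map G l ⊓ 𝓟 K) inf_le_right
  exact ⟨z, hz.mono inf_le_left⟩

/-- A normal form takes the value zero at a pole, whence the first alternative at the pole itself.
-/
theorem eventually_eq_zero_or_lt_norm {F : ℂ → ℂ} {z : ℂ} (hF : MeromorphicNFAt F z)
    (h : ¬ AnalyticAt ℂ F z) (K : ℝ) : ∀ᶠ y in 𝓝 z, F y = 0 ∨ K < ‖F y‖ := by
  obtain ⟨h0, h1⟩ := eq_zero_and_tendsto_of_not_analyticAt hF h
  have h3 := h1.eventually ((tendsto_norm_cobounded_atTop (E := ℂ)).eventually_gt_atTop K)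
  rw [eventually_nhdsWithin_iff] at h3
  filter_upwards [h3] with y hy
  by_cases hyz : y = z
  · exact Or.inl (hyz ▸ h0)
  · exact Or.inr (hy hyz)

/-- Away from the exceptional value zero, a cluster point of a family along which `F` converges is
mapped to the limit. -/
theorem eq_of_mapClusterPt {F : ℂ → ℂ} {z w : ℂ} (hF : MeromorphicNFAt F z) (hw : w ≠ 0)
    {α : Type*} {l : Filter α} {G : α → ℂ} (hz : MapClusterPt z l G)
    (hlim : Tendsto (fun x => F (G x)) l (𝓝 w)) : AnalyticAt ℂ F z ∧ F z = w := by
  have han : AnalyticAt ℂ F z := by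
    by_contra h
    have h2 := eventually_eq_zero_or_lt_norm hF h (‖w‖ + 1)
    have h4 : ∀ᶠ x in l, F (G x) ≠ 0 ∧ ‖F (G x)‖ < ‖w‖ + 1 :=
      (hlim.eventually_ne hw).and (hlim.norm.eventually_lt_const (by linarith))
    obtain ⟨x, hx, hx'⟩ := ((mapClusterPt_iff_frequently.mp hz _ h2).and_eventually h4).exists
    rcases hx with hx | hx
    · exact hx'.1 hx
    · exact lt_asymm hx hx'.2
  refine ⟨han, ?_⟩
  have h1 : MapClusterPt (F z) l (fun x => F (G x)) := hz.continuousAt_comp han.continuousAt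
  by_contra hne
  exact (disjoint_nhds_nhds.mpr hne).symm.le_bot.not_gt <| by
    have h2 : ClusterPt (F z) (𝓝 w) := ClusterPt.mono h1 hlim
    rw [inf_comm]
    exact bot_lt_iff_ne_bot.mpr h2.ne

namespace UnramifiedAbove

variable {F : ℂ → ℂ} {L : ℝ} (hF : UnramifiedAbove F L)
include hF

theorem analyticAt {z : ℂ} (hz : Real.exp L < ‖F z‖) : AnalyticAt ℂ F z := by
  by_contra h
  rw [(eq_zero_and_tendsto_of_not_analyticAt (hF.normalForm z) h).1, norm_zero] at hz
  exact lt_asymm hz (Real.exp_pos L)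

theorem isOpen : IsOpen {z | Real.exp L < ‖F z‖} := by
  rw [isOpen_iff_mem_nhds]
  intro z hz
  exact (hF.analyticAt hz).continuousAt.norm.eventually_const_lt hz

theorem exists_openPartialHomeomorph {z : ℂ} (hz : Real.exp L < ‖F z‖) :
    ∃ e : OpenPartialHomeomorph ℂ ℂ, z ∈ e.source ∧ ⇑e = F := by
  have h := ((hF.analyticAt hz).hasStrictDerivAt).hasStrictFDerivAt_equiv (hF.deriv_ne_zero z hz)
  exact ⟨h.toOpenPartialHomeomorph F, h.mem_toOpenPartialHomeomorph_source,
    h.toOpenPartialHomeomorph_coe⟩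

theorem isLocalHomeomorph :
    IsLocalHomeomorph fun z : {z | Real.exp L < ‖F z‖} => F z := by
  have h1 : IsLocalHomeomorphOn F {z | Real.exp L < ‖F z‖} :=
    IsLocalHomeomorphOn.mk _ _ fun z hz => by
      obtain ⟨e, he, he'⟩ := hF.exists_openPartialHomeomorph hz
      exact ⟨e, he, fun x _ => by rw [he']⟩
  rw [isLocalHomeomorph_iff_isLocalHomeomorphOn_univ]
  exact h1.comp (isLocalHomeomorph_iff_isLocalHomeomorphOn_univ.mp
    hF.isOpen.isOpenEmbedding_subtypeVal.isLocalHomeomorph) fun z _ => z.2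

/-- Uniqueness of lifts. -/
theorem eqOn_of_lift {X : Type*} [TopologicalSpace X] {S : Set X} (hS : IsPreconnected S)
    {g₁ g₂ : X → ℂ} (h₁ : ContinuousOn g₁ S) (h₂ : ContinuousOn g₂ S)
    (hlift : ∀ x ∈ S, F (g₁ x) = F (g₂ x)) (hL : ∀ x ∈ S, Real.exp L < ‖F (g₁ x)‖)
    {x₀ : X} (hx₀ : x₀ ∈ S) (heq : g₁ x₀ = g₂ x₀) : EqOn g₁ g₂ S := by
  have := isPreconnected_iff_preconnectedSpace.mp hS
  let G₁ : S → {z | Real.exp L < ‖F z‖} := fun x => ⟨g₁ x, hL x x.2⟩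
  let G₂ : S → {z | Real.exp L < ‖F z‖} := fun x => ⟨g₂ x, by
    rw [mem_ofPred_eq, ← hlift x x.2]; exact hL x x.2⟩
  have hG := (T2Space.isSeparatedMap fun z : {z | Real.exp L < ‖F z‖} => F z).eq_of_comp_eq
    hF.isLocalHomeomorph.isLocallyInjective (g₁ := G₁) (g₂ := G₂)
    ((continuousOn_iff_continuous_domRestrict.mp h₁).subtype_mk _)
    ((continuousOn_iff_continuous_domRestrict.mp h₂).subtype_mk _)
    (funext fun x => hlift x x.2) ⟨x₀, hx₀⟩ (Subtype.ext heq)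
  intro x hx
  exact congrArg Subtype.val (congrFun hG ⟨x, hx⟩)

/-- Path lifting. -/
theorem exists_path_lift {c : ℝ → ℂ} (hc : Continuous c) (hcL : ∀ s, Real.exp L < ‖c s‖)
    (hc0 : ∀ s ≤ 0, c s = c 0) {z₀ : ℂ} (hz₀ : F z₀ = c 0) (s : ℝ) :
    ∃ Γ : ℝ → ℂ, ContinuousOn Γ (Iic s) ∧ (∀ x ≤ 0, Γ x = z₀) ∧ ∀ x ≤ s, F (Γ x) = c x := by
  -- Continuation argument: S is the set of times up to which a lift exists, and its supremum σ is
  -- shown to be exceeded. Since c is constant on (-∞, 0], there is a left neighbourhood to work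
  -- with even if σ = 0.
  set S : Set ℝ := {s | ∃ Γ : ℝ → ℂ, ContinuousOn Γ (Iic s) ∧ (∀ x ≤ 0, Γ x = z₀) ∧
    ∀ x ≤ s, F (Γ x) = c x} with hSdef
  by_contra hs
  have hdown : ∀ a ∈ S, ∀ b ≤ a, b ∈ S := by
    rintro a ⟨Γ, h1, h2, h3⟩ b hb
    exact ⟨Γ, h1.mono (Iic_subset_Iic.mpr hb), h2, fun x hx => h3 x (hx.trans hb)⟩
  have hbdd : BddAbove S := ⟨s, fun a ha => le_of_not_gt fun h => hs (hdown a ha s h.le)⟩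
  have h0 : (0 : ℝ) ∈ S := ⟨fun _ => z₀, continuousOn_const, fun _ _ => rfl,
    fun x hx => by rw [hz₀, hc0 x hx]⟩
  set σ := sSup S with hσ
  have hlt : ∀ a < σ, a ∈ S := fun a ha => by
    obtain ⟨b, hb, hab⟩ := exists_lt_of_lt_csSup ⟨0, h0⟩ ha
    exact hdown b hb a hab.le
  have hσ0 : 0 ≤ σ := le_csSup hbdd h0
  choose! Γ hΓc hΓ0 hΓF using hlt
  have hagree : ∀ a < σ, ∀ b < σ, a ≤ b → EqOn (Γ a) (Γ b) (Iic a) := by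
    intro a ha b hb hab
    have hmin : min a 0 ∈ Iic a := mem_Iic.mpr (min_le_left _ _)
    refine hF.eqOn_of_lift isPreconnected_Iic (hΓc a ha)
      ((hΓc b hb).mono (Iic_subset_Iic.mpr hab)) (fun x hx => ?_) (fun x hx => ?_) hmin ?_
    · rw [hΓF a ha x hx, hΓF b hb x (le_trans hx hab)]
    · rw [hΓF a ha x hx]; exact hcL x
    · rw [hΓ0 a ha _ (min_le_right _ _), hΓ0 b hb _ (min_le_right _ _)]
  -- Uniqueness of lifts makes the lifts Γ a compatible, so the diagonal glues them on (-∞, σ).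
  set G : ℝ → ℂ := fun x => Γ x x with hG
  have hGeq : ∀ a < σ, EqOn G (Γ a) (Iic a) := fun a ha x hx =>
    hagree x (lt_of_le_of_lt hx ha) a ha hx self_mem_Iic
  have hGF : ∀ x < σ, F (G x) = c x := fun x hx => hΓF x hx x le_rfl
  have hGc : ContinuousOn G (Iio σ) := by
    intro x hx
    obtain ⟨b, hxb, hb⟩ := exists_between (mem_Iio.mp hx)
    have h1 : ContinuousOn G (Iic b) := (hΓc b hb).congr (hGeq b hb)
    exact (h1.continuousAt (Iic_mem_nhds hxb)).continuousWithinAt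
  have hlimc : Tendsto (fun x => F (G x)) (𝓝[<] σ) (𝓝 (c σ)) := by
    refine (hc.continuousAt.tendsto.mono_left nhdsWithin_le_nhds).congr' ?_
    filter_upwards [self_mem_nhdsWithin] with x hx
    exact (hGF x hx).symm
  -- If the lift clusters at z as x → σ, then F z = c σ and a local inverse at z carries the lift
  -- past σ. Otherwise the lift tends to infinity and c σ is an asymptotic value, which is excluded.
  by_cases hcl : ∃ z, MapClusterPt z (𝓝[<] σ) G
  · obtain ⟨z, hz⟩ := hcl
    have hcσ : c σ ≠ 0 := norm_pos_iff.mp ((Real.exp_pos L).trans (hcL σ))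
    have hFz := (eq_of_mapClusterPt (hF.normalForm z) hcσ hz hlimc).2
    obtain ⟨e, hez, heF⟩ := hF.exists_openPartialHomeomorph (z := z) (by rw [hFz]; exact hcL σ)
    have htgt : c σ ∈ e.target := by
      rw [← hFz, ← heF]; exact e.map_source hez
    obtain ⟨δ, hδ, hball⟩ := Metric.isOpen_iff.mp (e.open_target.preimage hc) σ htgt
    obtain ⟨a, hae, ha⟩ := ((mapClusterPt_iff_frequently.mp hz _
      (e.open_source.mem_nhds hez)).and_eventually
      (Ioo_mem_nhdsLT (show σ - δ < σ by linarith))).exists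
    have hmem : ∀ x ∈ Icc a (σ + δ / 2), c x ∈ e.target := fun x hx => hball (by
      rw [Metric.mem_ball, Real.dist_eq, abs_lt]
      constructor <;> linarith [hx.1, hx.2, ha.1])
    have hG0 : ∀ x ≤ 0, x < σ → G x = z₀ := fun x hx hx' => hΓ0 x hx' x hx
    have hsymm : e.symm (c a) = G a := by
      rw [← hGF a ha.2, ← heF, e.left_inv hae]
    have hnew : σ + δ / 2 ∈ S := by
      refine ⟨fun x => if x ≤ a then G x else e.symm (c x), ?_, fun x hx => ?_, fun x hx => ?_⟩
      · refine ContinuousOn.if ?_ ?_ ?_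
        · rintro x ⟨-, hx⟩
          have hxa : x = a := frontier_le_subset_eq continuous_id continuous_const hx
          rw [hxa, hsymm]
        · refine hGc.mono fun x hx => ?_
          have hxa : x ≤ a := closure_minimal (fun y hy => hy) (isClosed_Iic (a := a)) hx.2
          exact hxa.trans_lt ha.2
        · refine e.continuousOn_symm.comp hc.continuousOn fun x hx => hmem x ⟨?_, hx.1⟩
          have h1 : {x : ℝ | ¬ x ≤ a} = Ioi a := by ext; simp
          have h2 := hx.2
          rw [h1, closure_Ioi] at h2
          exact h2
      · by_cases hxa : x ≤ a
        · simp only [hxa, if_true]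
          exact hG0 x hx (hxa.trans_lt ha.2)
        · simp only [hxa, if_false]
          have ha0 : a ≤ 0 := (not_le.mp hxa).le.trans hx
          rw [hc0 x hx, ← hc0 a ha0, hsymm, hG0 a ha0 ha.2]
      · by_cases hxa : x ≤ a
        · simp only [hxa, if_true]
          exact hGF x (hxa.trans_lt ha.2)
        · simp only [hxa, if_false]
          rw [← heF, e.right_inv (hmem x ⟨(not_le.mp hxa).le, hx⟩)]
    linarith [le_csSup hbdd hnew]
  · have hpos : ∀ t ∈ Ici (0 : ℝ), 0 < 1 + t := fun t ht => by linarith [mem_Ici.mp ht]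
    have hlim : Tendsto (fun t : ℝ => σ - 1 / (1 + t)) atTop (𝓝[<] σ) := by
      refine tendsto_nhdsWithin_iff.mpr ⟨?_, ?_⟩
      · have h1 : Tendsto (fun t : ℝ => 1 / (1 + t)) atTop (𝓝 0) := by
          simp only [one_div]
          exact (tendsto_atTop_add_const_left atTop (1 : ℝ) tendsto_id).inv_tendsto_atTop
        simpa using h1.const_sub σ
      · filter_upwards [eventually_ge_atTop 0] with t ht
        have := hpos t ht
        simp only [mem_Iio, sub_lt_self_iff]
        positivity
    refine hF.not_asymptotic (c σ) (fun t => G (σ - 1 / (1 + t))) (hcL σ) ?_ ?_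
      (hlimc.comp hlim)
    · refine hGc.comp ?_ fun t ht => ?_
      · exact continuousOn_const.sub (continuousOn_const.div (by fun_prop)
          fun t ht => (hpos t ht).ne')
      · have := hpos t ht
        simp only [mem_Iio, sub_lt_self_iff]
        positivity
    · suffices Tendsto G (𝓝[<] σ) (cocompact ℂ) from this.comp hlim
      by_contra h
      exact hcl (exists_mapClusterPt_of_not_tendsto_cocompact h)

/-- Every point where `|F|` is large is the value of a global branch of the inverse of `log F`. -/
theorem exists_isLogInverse {z₀ ζ₀ : ℂ} (hζ₀ : ζ₀ ∈ rightHalfPlane L)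
    (hz₀ : F z₀ = Complex.exp ζ₀) : ∃ ψ : ℂ → ℂ, IsLogInverse F L ψ ∧ ψ ζ₀ = z₀ := by
  -- Segment from ζ₀ to ζ with its parameter clamped to [0, 1]; ψ ζ is the endpoint of the lift of
  -- its exponential.
  let ℓ : ℂ → ℝ → ℂ := fun ζ s => ζ₀ + (max 0 (min 1 s) : ℝ) • (ζ - ζ₀)
  have hℓmem : ∀ ζ ∈ rightHalfPlane L, ∀ s, ℓ ζ s ∈ rightHalfPlane L := fun ζ hζ s =>
    (convex_rightHalfPlane L).add_smul_sub_mem hζ₀ hζ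
      ⟨le_max_left _ _, max_le zero_le_one (min_le_left _ _)⟩
  have hℓ0 : ∀ ζ, ∀ s ≤ 0, ℓ ζ s = ζ₀ := fun ζ s hs => by
    have : max 0 (min 1 s) = 0 := max_eq_left ((min_le_right _ _).trans hs)
    simp [ℓ, this]
  have hex : ∀ ζ ∈ rightHalfPlane L, ∃ Γ : ℝ → ℂ, ContinuousOn Γ (Iic 1) ∧
      (∀ x ≤ 0, Γ x = z₀) ∧ ∀ x ≤ 1, F (Γ x) = Complex.exp (ℓ ζ x) := fun ζ hζ =>
    hF.exists_path_lift (c := fun s => Complex.exp (ℓ ζ s)) (by fun_prop)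
      (fun s => exp_lt_norm_exp (hℓmem ζ hζ s))
      (fun s hs => by simp only [hℓ0 ζ s hs, hℓ0 ζ 0 le_rfl])
      (by simp only [hℓ0 ζ 0 le_rfl, hz₀]) 1
  choose! Γ hΓc hΓ0 hΓF using hex
  refine ⟨fun ζ => Γ ζ 1, ⟨?_, fun ζ hζ => ?_⟩, ?_⟩
  -- Each lift is continuous in time and all start at z₀; for a local homeomorphism this yields
  -- joint continuity in time and ζ.
  · let g : unitInterval × rightHalfPlane L → {z | Real.exp L < ‖F z‖} := fun x =>
      ⟨Γ x.2 x.1, by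
        rw [mem_ofPred_eq, hΓF x.2 x.2.2 x.1 x.1.2.2]
        exact exp_lt_norm_exp (hℓmem _ x.2.2 _)⟩
    let f : C(unitInterval × rightHalfPlane L, ℂ) :=
      ⟨fun x => Complex.exp (ℓ x.2 x.1), by fun_prop⟩
    have hg : Continuous g := hF.isLocalHomeomorph.continuous_lift (T2Space.isSeparatedMap _) f
      (funext fun x => hΓF x.2 x.2.2 x.1 x.1.2.2)
      (by
        refine Continuous.subtype_mk ?_ _
        have : (fun ζ : rightHalfPlane L => Γ ζ ((0 : unitInterval) : ℝ)) = fun _ => z₀ :=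
          funext fun ζ => hΓ0 ζ ζ.2 _ (by simp)
        change Continuous fun ζ : rightHalfPlane L => Γ ζ ((0 : unitInterval) : ℝ)
        rw [this]
        exact continuous_const)
      (fun ζ => Continuous.subtype_mk
        ((hΓc ζ ζ.2).comp_continuous continuous_subtype_val fun t => t.2.2) _)
    rw [continuousOn_iff_continuous_domRestrict]
    have h1 : Continuous fun ζ : rightHalfPlane L => (g (1, ζ) : ℂ) :=
      continuous_subtype_val.comp (hg.comp (by fun_prop))
    exact h1
  · rw [hΓF ζ hζ 1 le_rfl]
    simp [ℓ]
  · have h1 := hF.eqOn_of_lift (S := Iic (1 : ℝ)) isPreconnected_Iic (hΓc ζ₀ hζ₀)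
      (g₂ := fun _ => z₀) continuousOn_const
      (fun x hx => by rw [hΓF ζ₀ hζ₀ x hx, hz₀]; simp [ℓ])
      (fun x hx => by rw [hΓF ζ₀ hζ₀ x hx]; exact exp_lt_norm_exp (hℓmem _ hζ₀ x))
      (x₀ := 0) (mem_Iic.mpr zero_le_one) (hΓ0 ζ₀ hζ₀ 0 le_rfl)
    exact h1 (mem_Iic.mpr le_rfl)

end UnramifiedAbove

namespace IsLogInverse

variable {F ψ : ℂ → ℂ} {L : ℝ} (hψ : IsLogInverse F L ψ) (hF : UnramifiedAbove F L)
include hψ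

theorem exp_lt_norm {ζ : ℂ} (hζ : ζ ∈ rightHalfPlane L) : Real.exp L < ‖F (ψ ζ)‖ := by
  rw [hψ.map_eq ζ hζ]
  exact exp_lt_norm_exp hζ

include hF

/-- Near each point ψ is a holomorphic local inverse of F composed with exp. -/
theorem differentiableOn : DifferentiableOn ℂ ψ (rightHalfPlane L) := by
  intro ζ hζ
  have hL := hψ.exp_lt_norm hζ
  have hs := (hF.analyticAt hL).hasStrictDerivAt
  have hne := hF.deriv_ne_zero _ hL
  have hct : ContinuousAt ψ ζ :=
    hψ.continuousOn.continuousAt ((isOpen_rightHalfPlane L).mem_nhds hζ)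
  have hloc : (fun ξ => hs.localInverse F _ _ hne (Complex.exp ξ)) =ᶠ[𝓝 ζ] ψ := by
    filter_upwards [hct.eventually (hs.eventually_left_inverse hne),
      (isOpen_rightHalfPlane L).mem_nhds hζ] with ξ hξ hξL
    rw [← hψ.map_eq ξ hξL, hξ]
  have hd : HasDerivAt (hs.localInverse F _ _ hne) (deriv F (ψ ζ))⁻¹ (Complex.exp ζ) := by
    rw [← hψ.map_eq ζ hζ]
    exact (hs.to_localInverse hne).hasDerivAt
  exact ((hd.comp ζ (Complex.hasDerivAt_exp ζ)).congr_of_eventuallyEq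
    hloc.symm).differentiableAt.differentiableWithinAt

end IsLogInverse
end SingularValues

end

/-! ### Closure of the tract and limits of a branch as Re ζ → ∞ -/

section
open Filter Topology Set
open scoped Real

namespace SingularValues

/-- Off its frontier, the space splits into the disjoint open sets s and the complement of its
closure. Every later confinement argument rests on this. -/
theorem subset_of_disjoint_frontier {X : Type*} [TopologicalSpace X] {s t : Set X}
    (ht : IsPreconnected t) (hs : IsOpen s) (hne : (t ∩ s).Nonempty)
    (hfr : ∀ x ∈ t, x ∉ frontier s) : t ⊆ s := by
  refine ht.subset_left_of_subset_union hs isClosed_closure.isOpen_compl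
    (disjoint_compl_right.mono_left subset_closure |>.mono_right le_rfl) (fun x hx => ?_) hne
  by_cases hxs : x ∈ s
  · exact Or.inl hxs
  · refine Or.inr fun hcl => hfr x hx ?_
    rw [hs.frontier_eq]
    exact ⟨hcl, hxs⟩

theorem isPreconnected_compl_closedBall {K : ℝ} (hK : 0 < K) :
    IsPreconnected {z : ℂ | K < ‖z‖} := by
  have : {z : ℂ | K < ‖z‖} = Complex.exp '' rightHalfPlane (Real.log K) := by
    ext z
    constructor
    · intro hz
      have hz0 : z ≠ 0 := norm_pos_iff.mp (hK.trans hz)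
      refine ⟨Complex.log z, ?_, Complex.exp_log hz0⟩
      rw [rightHalfPlane, mem_ofPred_eq, Complex.log_re]
      exact Real.log_lt_log hK hz
    · rintro ⟨ζ, hζ, rfl⟩
      rw [mem_ofPred_eq, Complex.norm_exp, ← Real.log_lt_iff_lt_exp hK]
      exact hζ
  rw [this]
  exact (convex_rightHalfPlane _).isPreconnected.image _ Complex.continuous_exp.continuousOn

theorem isPreconnected_ball_diff_center (c : ℂ) {δ : ℝ} (hδ : 0 < δ) :
    IsPreconnected (Metric.ball c δ \ {c}) := by
  have : Metric.ball c δ \ {c} =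
      (fun ζ => c + Complex.exp ζ) '' {ζ | ζ.re < Real.log δ} := by
    ext z
    constructor
    · rintro ⟨hz, hz'⟩
      have hz0 : z - c ≠ 0 := sub_ne_zero.mpr hz'
      refine ⟨Complex.log (z - c), ?_, ?_⟩
      · rw [mem_ofPred_eq, Complex.log_re]
        exact Real.log_lt_log (norm_pos_iff.mpr hz0) (by rwa [← dist_eq_norm])
      · simp only [Complex.exp_log hz0]; ring
    · rintro ⟨ζ, hζ, rfl⟩
      refine ⟨?_, ?_⟩
      · rw [Metric.mem_ball, dist_eq_norm, add_sub_cancel_left, Complex.norm_exp,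
          ← Real.lt_log_iff_exp_lt hδ]
        exact hζ
      · simp [Complex.exp_ne_zero]
  rw [this]
  exact (convex_halfSpace_re_lt _).isPreconnected.image _ (by fun_prop)

theorem eventually_rightHalfPlane (T : ℝ) :
    ∀ᶠ ζ : ℂ in comap Complex.re atTop, ζ ∈ rightHalfPlane T :=
  tendsto_comap.eventually_gt_atTop T

namespace IsLogInverse

variable {F ψ : ℂ → ℂ} {L : ℝ} (hψ : IsLogInverse F L ψ) (hF : UnramifiedAbove F L)
include hψ

theorem ne_zero {ζ : ℂ} (hζ : ζ ∈ rightHalfPlane L) : F (ψ ζ) ≠ 0 := by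
  rw [hψ.map_eq ζ hζ]
  exact Complex.exp_ne_zero ζ

theorem norm_eq {ζ : ℂ} (hζ : ζ ∈ rightHalfPlane L) : ‖F (ψ ζ)‖ = Real.exp ζ.re := by
  rw [hψ.map_eq ζ hζ, Complex.norm_exp]

include hF

/-- Differentiating F ∘ ψ = exp shows that ψ' has no zero, so ψ is open by the inverse function
theorem. -/
theorem isOpen_image {U : Set ℂ} (hU : IsOpen U) (hUL : U ⊆ rightHalfPlane L) :
    IsOpen (ψ '' U) := by
  rw [isOpen_iff_mem_nhds]
  rintro _ ⟨ζ, hζ, rfl⟩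
  have hnhds : rightHalfPlane L ∈ 𝓝 ζ := (isOpen_rightHalfPlane L).mem_nhds (hUL hζ)
  have hd := hψ.differentiableOn hF
  have han : AnalyticAt ℂ ψ ζ := hd.analyticAt hnhds
  have hne : deriv ψ ζ ≠ 0 := by
    intro h0
    have h1 := (hF.analyticAt (hψ.exp_lt_norm (hUL hζ))).differentiableAt.hasDerivAt.comp ζ
      han.differentiableAt.hasDerivAt
    have h2 : HasDerivAt (F ∘ ψ) (Complex.exp ζ) ζ :=
      (Complex.hasDerivAt_exp ζ).congr_of_eventuallyEq (by
        filter_upwards [hnhds] with ξ hξ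
        exact hψ.map_eq ξ hξ)
    have h3 := h2.unique h1
    rw [h0, mul_zero] at h3
    exact Complex.exp_ne_zero ζ h3
  rw [← han.hasStrictDerivAt.map_nhds_eq hne]
  exact image_mem_map (hU.mem_nhds hζ)

/-- The image of a closed half plane is closed in the domain of analyticity of `F`. -/
theorem mem_image_of_mem_closure {L' : ℝ} (hL' : L < L') {z : ℂ}
    (hz : z ∈ closure (ψ '' {ζ | L' ≤ ζ.re})) (han : AnalyticAt ℂ F z) :
    z ∈ ψ '' {ζ | L' ≤ ζ.re} := by
  obtain ⟨x, hx, hxz⟩ := mem_closure_iff_seq_limit.mp hz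
  choose ζ hζ hζx using hx
  have hζL : ∀ n, ζ n ∈ rightHalfPlane L := fun n => lt_of_lt_of_le hL' (hζ n)
  have hlim : Tendsto (fun n => Complex.exp (ζ n)) atTop (𝓝 (F z)) := by
    refine (han.continuousAt.tendsto.comp hxz).congr fun n => ?_
    simp only [Function.comp_apply]
    rw [← hζx n, hψ.map_eq _ (hζL n)]
  have hw : Real.exp L' ≤ ‖F z‖ := ge_of_tendsto hlim.norm
    (Eventually.of_forall fun n => by
      rw [Complex.norm_exp]; exact Real.exp_le_exp.mpr (hζ n))
  have hwL : Real.exp L < ‖F z‖ := (Real.exp_lt_exp.mpr hL').trans_le hw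
  have hw0 : F z ≠ 0 := norm_pos_iff.mp ((Real.exp_pos L).trans hwL)
  -- The preimages ζ n may have unbounded imaginary parts, so compactness is not available. Instead
  -- a local inverse of F at z is used on balls about ζ n of a radius ρ independent of n; ρ ≤ L' - L
  -- keeps them in the half plane.
  obtain ⟨e, hez, heF⟩ := hF.exists_openPartialHomeomorph hwL
  have htgt : F z ∈ e.target := by
    rw [← heF]; exact e.map_source hez
  have hcont : Tendsto (fun p : ℂ × ℂ => p.1 * Complex.exp p.2) (𝓝 (F z, 0)) (𝓝 (F z)) := by
    have : Continuous fun p : ℂ × ℂ => p.1 * Complex.exp p.2 := by fun_prop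
    simpa using this.tendsto (F z, 0)
  have hev := hcont.eventually (e.open_target.mem_nhds htgt)
  rw [nhds_prod_eq, Filter.eventually_prod_iff] at hev
  obtain ⟨p, hp, q, hq, hpq⟩ := hev
  obtain ⟨ρ₀, hρ₀, hball⟩ := Metric.eventually_nhds_iff_ball.mp hq
  set ρ := min ρ₀ (L' - L) with hρdef
  have hρ : 0 < ρ := lt_min hρ₀ (sub_pos.mpr hL')
  have hdiff : Tendsto (fun n => Complex.log (F z / Complex.exp (ζ n))) atTop (𝓝 0) := by
    have h1 : Tendsto (fun n => F z / Complex.exp (ζ n)) atTop (𝓝 1) := by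
      have := (tendsto_const_nhds (x := F z)).div hlim hw0
      rwa [div_self hw0] at this
    have h2 := (continuousAt_clog Complex.one_mem_slitPlane).tendsto.comp h1
    rw [Complex.log_one] at h2
    exact h2
  obtain ⟨n, hpn, hnball, hsrc⟩ := ((hlim.eventually hp).and
    ((hdiff.eventually (Metric.ball_mem_nhds 0 hρ)).and
      (hxz.eventually (e.open_source.mem_nhds hez)))).exists
  have hsub : Metric.ball (ζ n) ρ ⊆ rightHalfPlane L := by
    intro ξ hξ
    have h1 : ‖ξ - ζ n‖ < L' - L := by
      rw [← dist_eq_norm]; exact (Metric.mem_ball.mp hξ).trans_le (min_le_right _ _)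
    have h2 := (abs_lt.mp ((Complex.abs_re_le_norm (ξ - ζ n)).trans_lt h1)).1
    have h3 : L' ≤ (ζ n).re := hζ n
    rw [Complex.sub_re] at h2
    change L < ξ.re
    linarith
  have htgt' : ∀ ξ ∈ Metric.ball (ζ n) ρ, Complex.exp ξ ∈ e.target := by
    intro ξ hξ
    have h1 : ξ - ζ n ∈ Metric.ball (0 : ℂ) ρ₀ := by
      rw [mem_ball_zero_iff, ← dist_eq_norm]
      exact (Metric.mem_ball.mp hξ).trans_le (min_le_left _ _)
    have h2 := hpq hpn (hball _ h1)
    rw [← Complex.exp_add, add_sub_cancel] at h2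
    exact h2
  have hEq := hF.eqOn_of_lift (Metric.isPreconnected_ball (x := ζ n) (r := ρ))
    (hψ.continuousOn.mono hsub) (g₂ := fun ξ => e.symm (Complex.exp ξ))
    (e.continuousOn_symm.comp Complex.continuous_exp.continuousOn htgt')
    (fun ξ hξ => by rw [hψ.map_eq ξ (hsub hξ), ← heF, e.right_inv (htgt' ξ hξ)])
    (fun ξ hξ => hψ.exp_lt_norm (hsub hξ)) (Metric.mem_ball_self hρ)
    (by rw [← hψ.map_eq _ (hζL n), hζx n, ← heF, e.left_inv hsrc])
  -- On the ball ψ is the local inverse composed with exp, so the nearby logarithm ξ of F z is sent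
  -- to z.
  set ξ := ζ n + Complex.log (F z / Complex.exp (ζ n)) with hξ
  have hexp : Complex.exp ξ = F z := by
    rw [hξ, Complex.exp_add, Complex.exp_log (div_ne_zero hw0 (Complex.exp_ne_zero _)),
      mul_div_cancel₀ _ (Complex.exp_ne_zero _)]
  have hmem : ξ ∈ Metric.ball (ζ n) ρ := by
    rw [Metric.mem_ball, dist_eq_norm, hξ, add_sub_cancel_left]
    exact mem_ball_zero_iff.mp hnball
  refine ⟨ξ, ?_, ?_⟩
  · rw [← hexp, Complex.norm_exp] at hw
    exact Real.exp_le_exp.mp hw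
  · rw [hEq hmem]
    simp only
    rw [hexp, ← heF, e.left_inv hez]

/-- Near a pole |F| is large, and |F(ψ ζ)| = exp(Re ζ), so points of the tract approaching the pole
have Re ζ → ∞. -/
theorem mapClusterPt_of_mem_closure {L' : ℝ} (hL' : L < L') {z : ℂ}
    (hz : z ∈ closure (ψ '' {ζ | L' ≤ ζ.re})) (han : ¬ AnalyticAt ℂ F z) :
    MapClusterPt z (comap Complex.re atTop) ψ := by
  rw [mapClusterPt_iff_frequently]
  intro U hU
  rw [(atTop_basis_Ioi.comap Complex.re).frequently_iff]
  intro T _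
  have h1 := eventually_eq_zero_or_lt_norm (hF.normalForm z) han (Real.exp T)
  obtain ⟨y, ⟨hyU, hy⟩, ζ, hζ, rfl⟩ := mem_closure_iff_nhds.mp hz _ (inter_mem hU h1)
  have hζL : ζ ∈ rightHalfPlane L := lt_of_lt_of_le hL' hζ
  rcases hy with hy | hy
  · exact absurd hy (hψ.ne_zero hζL)
  · rw [hψ.norm_eq hζL] at hy
    exact ⟨ζ, Real.exp_lt_exp.mp hy, hyU⟩

/-- A finite cluster point must be a pole, because |F ∘ ψ| = exp(Re ζ) → ∞. On a small circle about
the pole |F| is bounded, so for large T the connected image of Re ζ > T misses the circle and stays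
inside it. -/
theorem tendsto_cocompact_or :
    Tendsto ψ (comap Complex.re atTop) (cocompact ℂ) ∨
      ∃ z, ¬ AnalyticAt ℂ F z ∧ Tendsto ψ (comap Complex.re atTop) (𝓝 z) := by
  refine or_iff_not_imp_left.mpr fun h => ?_
  obtain ⟨z, hz⟩ := exists_mapClusterPt_of_not_tendsto_cocompact h
  have han : ¬ AnalyticAt ℂ F z := by
    intro han
    have h1 : ∀ᶠ y in 𝓝 z, ‖F y‖ < ‖F z‖ + 1 :=
      han.continuousAt.norm.eventually_lt_const (by linarith)
    have h2 := eventually_rightHalfPlane (max L (Real.log (‖F z‖ + 1)))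
    obtain ⟨ζ, hζ, hζ'⟩ :=
      ((mapClusterPt_iff_frequently.mp hz _ h1).and_eventually h2).exists
    have hζL : ζ ∈ rightHalfPlane L := rightHalfPlane_subset (le_max_left _ _) hζ'
    have h3 : Real.log (‖F z‖ + 1) < ζ.re := (le_max_right _ _).trans_lt hζ'
    rw [mem_ofPred_eq, hψ.norm_eq hζL] at hζ
    rw [Real.log_lt_iff_lt_exp (by positivity)] at h3
    exact lt_asymm hζ h3
  refine ⟨z, han, ?_⟩
  rw [Metric.nhds_basis_ball.tendsto_right_iff]
  intro ε hε
  have hpunct := (hF.normalForm z).meromorphicAt.eventually_analyticAt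
  rw [eventually_nhdsWithin_iff] at hpunct
  obtain ⟨δ₀, hδ₀, hball⟩ := Metric.eventually_nhds_iff_ball.mp hpunct
  set δ := min (δ₀ / 2) ε with hδdef
  have hδ : 0 < δ := lt_min (by linarith) hε
  have hδδ₀ : δ < δ₀ := (min_le_left _ _).trans_lt (by linarith)
  have hcont : ContinuousOn F (Metric.sphere z δ) := fun y hy =>
    (hball y (Metric.mem_ball.mpr (by rw [Metric.mem_sphere.mp hy]; exact hδδ₀))
      (Metric.ne_of_mem_sphere hy hδ.ne')).continuousAt.continuousWithinAt
  obtain ⟨K, hK⟩ := (isCompact_sphere z δ).exists_bound_of_continuousOn hcont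
  set T := max L (Real.log (max K 1)) with hT
  have hTL : rightHalfPlane T ⊆ rightHalfPlane L := rightHalfPlane_subset (le_max_left _ _)
  have hsub : ψ '' rightHalfPlane T ⊆ Metric.ball z δ := by
    refine subset_of_disjoint_frontier ((convex_rightHalfPlane T).isPreconnected.image _
      (hψ.continuousOn.mono hTL)) Metric.isOpen_ball ?_ ?_
    · obtain ⟨ζ, hζ, hζ'⟩ := ((mapClusterPt_iff_frequently.mp hz _
        (Metric.ball_mem_nhds z hδ)).and_eventually (eventually_rightHalfPlane T)).exists
      exact ⟨ψ ζ, ⟨ζ, hζ', rfl⟩, hζ⟩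
    · rintro _ ⟨ζ, hζ, rfl⟩ hfr
      have h1 := hK _ (Metric.frontier_ball_subset_sphere hfr)
      rw [hψ.norm_eq (hTL hζ)] at h1
      have h2 : Real.log (max K 1) < ζ.re := (le_max_right _ _).trans_lt hζ
      rw [Real.log_lt_iff_lt_exp (by positivity)] at h2
      exact absurd h1 (not_le.mpr ((le_max_left _ _).trans_lt h2))
  filter_upwards [eventually_rightHalfPlane T] with ζ hζ
  exact Metric.ball_subset_ball (min_le_right _ _) (hsub ⟨ζ, hζ, rfl⟩)

/-- If ψ tended to a pole, the points T + 1 + 2πin would have bounded images with a common value of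
F. At a cluster point of these images F is locally injective, which forces ψ to take equal values at
two of the points. -/
theorem tendsto_cocompact_of_injOn (hinj : InjOn ψ (rightHalfPlane L)) :
    Tendsto ψ (comap Complex.re atTop) (cocompact ℂ) := by
  refine (hψ.tendsto_cocompact_or hF).resolve_right ?_
  rintro ⟨z, -, hz⟩
  have h1 := (hz.eventually (Metric.closedBall_mem_nhds z one_pos)).and
    (eventually_rightHalfPlane L)
  obtain ⟨T, -, hT⟩ := (atTop_basis_Ioi.comap Complex.re).eventually_iff.mp h1
  set ζ : ℕ → ℂ := fun n => (T + 1 : ℝ) + n * (2 * π * Complex.I) with hζdef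
  have hre : ∀ n, (ζ n).re = T + 1 := fun n => by simp [hζdef]
  have hζ : ∀ n, ψ (ζ n) ∈ Metric.closedBall z 1 ∧ ζ n ∈ rightHalfPlane L := fun n =>
    hT (by simp [hre])
  have hζinj : Function.Injective ζ := by
    intro m n hmn
    have h2 : (2 * π * Complex.I : ℂ) ≠ 0 := by simp [Real.pi_ne_zero]
    have := mul_right_cancel₀ h2 (add_left_cancel hmn)
    exact_mod_cast this
  have hFζ : ∀ n, F (ψ (ζ n)) = Complex.exp ((T + 1 : ℝ) : ℂ) := fun n => by
    rw [hψ.map_eq _ (hζ n).2, hζdef]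
    simp only
    rw [Complex.exp_add, Complex.exp_nat_mul_two_pi_mul_I, mul_one]
  have hnt : ¬ Tendsto (fun n => ψ (ζ n)) atTop (cocompact ℂ) := by
    intro h
    obtain ⟨n, hn⟩ := (h.eventually
      (isCompact_closedBall z 1).compl_mem_cocompact).exists
    exact hn (hζ n).1
  obtain ⟨y, hy⟩ := exists_mapClusterPt_of_not_tendsto_cocompact hnt
  have hFy := (eq_of_mapClusterPt (hF.normalForm y) (Complex.exp_ne_zero ((T + 1 : ℝ) : ℂ)) hy
    (tendsto_const_nhds.congr fun n => (hFζ n).symm)).2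
  have hyL : Real.exp L < ‖F y‖ := by
    rw [hFy, ← hFζ 0]; exact hψ.exp_lt_norm (hζ 0).2
  obtain ⟨e, hey, heF⟩ := hF.exists_openPartialHomeomorph hyL
  have hfreq := mapClusterPt_iff_frequently.mp hy _ (e.open_source.mem_nhds hey)
  obtain ⟨m, -, hm⟩ := frequently_atTop.mp hfreq 0
  obtain ⟨n, hn, hn'⟩ := frequently_atTop.mp hfreq (m + 1)
  have h2 : ψ (ζ m) = ψ (ζ n) := e.injOn hm hn' (by rw [heF, hFζ, hFζ])
  have := hζinj (hinj (hζ m).2 (hζ n).2 h2)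
  omega

end IsLogInverse
end SingularValues

end

/-! ### Periodic branches and injectivity -/

section
open Filter Topology Set
open scoped Real

namespace SingularValues

theorem not_mapClusterPt_of_tendsto_cocompact {X : Type*} {l : Filter X} {G : X → ℂ}
    (htend : Tendsto G l (cocompact ℂ)) (z : ℂ) : ¬ MapClusterPt z l G := by
  intro h
  obtain ⟨ζ, h1, h2⟩ := ((mapClusterPt_iff_frequently.mp h _
    (Metric.closedBall_mem_nhds z one_pos)).and_eventually
    (htend.eventually (isCompact_closedBall z 1).compl_mem_cocompact)).exists
  exact h2 h1

instance neBot_comap_re_atTop : (comap Complex.re atTop).NeBot :=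
  comap_neBot_iff_frequently.mpr (Frequently.of_forall fun x => ⟨x, Complex.ofReal_re x⟩)

namespace IsLogInverse

variable {F ψ : ℂ → ℂ} {L : ℝ} (hψ : IsLogInverse F L ψ) (hF : UnramifiedAbove F L)
include hψ

/-- Modulo the period the strip is a compact rectangle. -/
theorem isBounded_image_strip {p : ℝ} (hp : 0 < p)
    (hper : ∀ ζ ∈ rightHalfPlane L, ∀ n : ℤ, ψ (ζ + n * (p * Complex.I)) = ψ ζ) {a b : ℝ}
    (ha : L < a) : Bornology.IsBounded (ψ '' {ζ | a ≤ ζ.re ∧ ζ.re ≤ b}) := by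
  have hK : IsCompact (Icc a b ×ℂ Icc 0 p) := isCompact_Icc.reProdIm isCompact_Icc
  have hKL : Icc a b ×ℂ Icc 0 p ⊆ rightHalfPlane L := fun ζ hζ => lt_of_lt_of_le ha hζ.1.1
  refine (hK.image_of_continuousOn (hψ.continuousOn.mono hKL)).isBounded.subset ?_
  rintro _ ⟨ζ, hζ, rfl⟩
  obtain ⟨n, hn, -⟩ := existsUnique_add_zsmul_mem_Ico hp ζ.im 0
  refine ⟨ζ + n * (p * Complex.I), ⟨?_, ?_⟩, hper ζ (lt_of_lt_of_le ha hζ.1) n⟩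
  · simpa using hζ
  · have h2 : (ζ + n * (p * Complex.I)).im = ζ.im + n • p := by simp
    rw [mem_preimage, h2]
    exact ⟨hn.1, by simpa using hn.2.le⟩

include hF

/-- If `ψ` is not injective then it is periodic with a purely imaginary period. -/
theorem exists_period (hinj : ¬ InjOn ψ (rightHalfPlane L)) :
    ∃ p : ℝ, 0 < p ∧ ∀ ζ ∈ rightHalfPlane L, ∀ n : ℤ, ψ (ζ + n * (p * Complex.I)) = ψ ζ := by
  have hexists : ∃ p : ℝ, 0 < p ∧ ∃ ζ ∈ rightHalfPlane L, ψ (ζ + p * Complex.I) = ψ ζ ∧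
      Complex.exp (p * Complex.I) = 1 := by
    simp only [InjOn, not_forall] at hinj
    obtain ⟨ζ₁, h₁, ζ₂, h₂, heq, hne⟩ := hinj
    have hexp : Complex.exp ζ₁ = Complex.exp ζ₂ := by
      rw [← hψ.map_eq ζ₁ h₁, ← hψ.map_eq ζ₂ h₂, heq]
    obtain ⟨k, hk⟩ := Complex.exp_eq_exp_iff_exists_int.mp hexp
    have hk0 : k ≠ 0 := by
      rintro rfl
      exact hne (by simpa using hk)
    have hper : ∀ m : ℤ, Complex.exp ((m * (2 * π) : ℝ) * Complex.I) = 1 := fun m => by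
      rw [Complex.exp_eq_one_iff]
      exact ⟨m, by push_cast; ring⟩
    have hpi := Real.pi_pos
    rcases lt_or_gt_of_ne hk0 with hneg | hpos
    · refine ⟨((-k : ℤ) : ℝ) * (2 * π), ?_, ζ₁, h₁, ?_, hper (-k)⟩
      · have : (0 : ℝ) < ((-k : ℤ) : ℝ) := by exact_mod_cast neg_pos.mpr hneg
        positivity
      · rw [heq, hk]
        congr 1
        push_cast
        ring
    · refine ⟨(k : ℝ) * (2 * π), ?_, ζ₂, h₂, ?_, hper k⟩
      · have : (0 : ℝ) < (k : ℝ) := by exact_mod_cast hpos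
        positivity
      · rw [← heq, hk]
        congr 1
        push_cast
        ring
  obtain ⟨p, hp, ζ₀, hζ₀, heq, hexp⟩ := hexists
  refine ⟨p, hp, ?_⟩
  have hmem : ∀ ζ ∈ rightHalfPlane L, ζ + p * Complex.I ∈ rightHalfPlane L := fun ζ hζ => by
    simpa [rightHalfPlane] using hζ
  -- Both sides lift exp, so agreement at the single point ζ₀ spreads over the half plane.
  have hEq := hF.eqOn_of_lift (convex_rightHalfPlane L).isPreconnected
    (g₁ := fun ζ => ψ (ζ + p * Complex.I)) (g₂ := ψ)
    (hψ.continuousOn.comp (by fun_prop) hmem) hψ.continuousOn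
    (fun ζ hζ => by rw [hψ.map_eq _ (hmem ζ hζ), hψ.map_eq ζ hζ, Complex.exp_add, hexp, mul_one])
    (fun ζ hζ => hψ.exp_lt_norm (hmem ζ hζ)) hζ₀ heq
  have hmem' : ∀ ζ ∈ rightHalfPlane L, ∀ n : ℤ,
      ζ + n * (p * Complex.I) ∈ rightHalfPlane L := fun ζ hζ n => by
    simpa [rightHalfPlane] using hζ
  intro ζ hζ n
  induction n with
  | zero => simp
  | succ n ih =>
    rw [← ih, ← hEq (hmem' ζ hζ n)]
    simp only
    congr 1
    push_cast
    ring
  | pred n ih =>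
    rw [← ih, ← hEq (hmem' ζ hζ (-n - 1))]
    simp only
    congr 1
    push_cast
    ring

/-- At an analytic point, the closed half plane has relatively closed image and the open one has
open image, so only the line Re ζ = L' remains; all other frontier points are poles. -/
theorem frontier_image_subset {L' : ℝ} (hL' : L < L') {z : ℂ}
    (hz : z ∈ frontier (ψ '' rightHalfPlane L')) :
    (∃ ζ, ζ.re = L' ∧ ψ ζ = z) ∨
      ¬ AnalyticAt ℂ F z ∧ MapClusterPt z (comap Complex.re atTop) ψ := by
  have hopen := hψ.isOpen_image hF (isOpen_rightHalfPlane L') (rightHalfPlane_subset hL'.le)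
  rw [hopen.frontier_eq] at hz
  have hcl : z ∈ closure (ψ '' {ζ | L' ≤ ζ.re}) :=
    closure_mono (image_mono (show rightHalfPlane L' ⊆ {ζ | L' ≤ ζ.re} from
      fun ζ hζ => le_of_lt (show L' < ζ.re from hζ))) hz.1
  by_cases han : AnalyticAt ℂ F z
  · obtain ⟨ζ, hζ, rfl⟩ := hψ.mem_image_of_mem_closure hF hL' hcl han
    exact Or.inl ⟨ζ, (hζ.eq_of_not_lt fun h => hz.2 ⟨ζ, h, rfl⟩).symm, rfl⟩
  · exact Or.inr ⟨han, hψ.mapClusterPt_of_mem_closure hF hL' hcl han⟩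

/-- If `F` is not large in a whole neighbourhood of infinity, then a branch of the inverse of
`log F` whose values are joined to infinity by a curve on which `F` is large is injective. -/
theorem injOn {L' : ℝ} (hL' : L < L') (hsmall : ∀ K : ℝ, ∃ z, K < ‖z‖ ∧ ‖F z‖ ≤ Real.exp L)
    {γ : ℝ → ℂ} (hγ : ContinuousOn γ (Ici 0)) (hγlim : Tendsto γ atTop (cocompact ℂ))
    (hγF : ∀ t ∈ Ici (0 : ℝ), Real.exp L' < ‖F (γ t)‖ ∨ ¬ AnalyticAt ℂ F (γ t))
    {ζ₀ : ℂ} (hζ₀ : ζ₀ ∈ rightHalfPlane L') (hγ₀ : ψ ζ₀ = γ 0) :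
    InjOn ψ (rightHalfPlane L) := by
  by_contra hinj
  obtain ⟨p, hp, hper⟩ := hψ.exists_period hF hinj
  have hsubL : rightHalfPlane L' ⊆ rightHalfPlane L := rightHalfPlane_subset hL'.le
  have hopen : IsOpen (ψ '' rightHalfPlane L') :=
    hψ.isOpen_image hF (isOpen_rightHalfPlane L') hsubL
  -- If ψ → ∞, the frontier of the tract is the image of a line, bounded by periodicity, so the
  -- tract contains a neighbourhood of ∞, against `hsmall`. If ψ tends to a pole z, the tract with z
  -- added is open and bounded and traps γ.
  rcases hψ.tendsto_cocompact_or hF with htend | ⟨z, hz, htend⟩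
  · obtain ⟨K₀, hK₀⟩ := (hψ.isBounded_image_strip hp hper (b := L') hL').exists_norm_le
    set K := max K₀ 1 with hK
    have hK1 : 0 < K := lt_of_lt_of_le one_pos (le_max_right _ _)
    have hsub : {z : ℂ | K < ‖z‖} ⊆ ψ '' rightHalfPlane L' := by
      refine subset_of_disjoint_frontier (isPreconnected_compl_closedBall hK1) hopen ?_ ?_
      · obtain ⟨ζ, h1, h2⟩ := ((htend.eventually
          (isCompact_closedBall (0 : ℂ) K).compl_mem_cocompact).and
          (show ∀ᶠ ζ in comap Complex.re atTop, ζ ∈ rightHalfPlane L' from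
            eventually_rightHalfPlane L')).exists
        exact ⟨ψ ζ, by simpa using h1, ζ, h2, rfl⟩
      · intro y hy hfr
        rcases hψ.frontier_image_subset hF hL' hfr with ⟨ζ, hζ, rfl⟩ | ⟨-, h⟩
        · exact absurd (hK₀ _ ⟨ζ, ⟨hζ.ge, hζ.le⟩, rfl⟩)
            (not_le.mpr ((le_max_left _ _).trans_lt hy))
        · exact not_mapClusterPt_of_tendsto_cocompact htend y h
    obtain ⟨y, hy, hyF⟩ := hsmall K
    obtain ⟨ζ, hζ, rfl⟩ := hsub hy
    exact absurd (hψ.exp_lt_norm (hsubL hζ)) (not_lt.mpr hyF)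
  · have huniq : ∀ y, MapClusterPt y (comap Complex.re atTop) ψ → y = z := fun y hy => by
      by_contra hne
      have h2 : ClusterPt y (𝓝 z) := ClusterPt.mono hy htend
      exact h2.ne (disjoint_iff.mp (disjoint_nhds_nhds.mpr hne))
    have hfr : ∀ y ∈ frontier (ψ '' rightHalfPlane L'),
        (∃ ζ, ζ.re = L' ∧ ψ ζ = y) ∨ y = z := fun y hy =>
      (hψ.frontier_image_subset hF hL' hy).imp_right fun h => huniq y h.2
    have hline : ∀ ζ : ℂ, ζ.re = L' → ‖F (ψ ζ)‖ = Real.exp L' := fun ζ hζ => by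
      rw [hψ.norm_eq (show L < ζ.re by rw [hζ]; exact hL'), hζ]
    have hz0 := (eq_zero_and_tendsto_of_not_analyticAt (hF.normalForm z) hz)
    have hnhds : ψ '' rightHalfPlane L' ∪ {z} ∈ 𝓝 z := by
      have h1 := hz0.2.eventually ((tendsto_norm_cobounded_atTop (E := ℂ)).eventually_gt_atTop
        (Real.exp L'))
      rw [eventually_nhdsWithin_iff] at h1
      obtain ⟨δ, hδ, hball⟩ := Metric.eventually_nhds_iff_ball.mp h1
      -- On the punctured disc |F| > exp L', whereas |F| = exp L' on the image of the line; hence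
      -- the disc meets no frontier point other than z.
      have hsub : Metric.ball z δ \ {z} ⊆ ψ '' rightHalfPlane L' := by
        refine subset_of_disjoint_frontier (isPreconnected_ball_diff_center z hδ) hopen ?_ ?_
        · obtain ⟨ζ, h2, h3⟩ := ((htend.eventually (Metric.ball_mem_nhds z hδ)).and
            (show ∀ᶠ ζ in comap Complex.re atTop, ζ ∈ rightHalfPlane L' from
              eventually_rightHalfPlane L')).exists
          refine ⟨ψ ζ, ⟨h2, fun h4 => ?_⟩, ζ, h3, rfl⟩
          rw [mem_singleton_iff] at h4
          exact hψ.ne_zero (hsubL h3) (h4 ▸ hz0.1)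
        · intro y hy hy'
          rcases hfr y hy' with ⟨ζ, hζ, rfl⟩ | h
          · exact absurd (hball _ hy.1 hy.2) (by rw [hline ζ hζ]; exact lt_irrefl _)
          · exact hy.2 h
      filter_upwards [Metric.ball_mem_nhds z hδ] with y hy
      by_cases hyz : y = z
      · exact Or.inr hyz
      · exact Or.inl (hsub ⟨hy, hyz⟩)
    have hVopen : IsOpen (ψ '' rightHalfPlane L' ∪ {z}) := by
      rw [isOpen_iff_mem_nhds]
      rintro y (hy | hy)
      · exact mem_of_superset (hopen.mem_nhds hy) subset_union_left
      · rw [mem_singleton_iff] at hy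
        rwa [hy]
    -- Leaving the set would require crossing the image of Re ζ = L', whose points are analytic with
    -- |F| = exp L'; `hγF` forbids this.
    have hγV : γ '' Ici 0 ⊆ ψ '' rightHalfPlane L' ∪ {z} := by
      refine subset_of_disjoint_frontier (isPreconnected_Ici.image _ hγ) hVopen
        ⟨γ 0, ⟨0, self_mem_Ici, rfl⟩, Or.inl ⟨ζ₀, hζ₀, hγ₀⟩⟩ ?_
      rintro _ ⟨t, ht, rfl⟩ hy
      rw [hVopen.frontier_eq, closure_union, closure_singleton] at hy
      have hyz : γ t ≠ z := fun h => hy.2 (Or.inr h)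
      have hycl : γ t ∈ frontier (ψ '' rightHalfPlane L') := by
        rw [hopen.frontier_eq]
        exact ⟨hy.1.resolve_right hyz, fun h => hy.2 (Or.inl h)⟩
      obtain ⟨ζ, hζ, hζt⟩ := (hfr _ hycl).resolve_right hyz
      rcases hγF t ht with h | h
      · rw [← hζt, hline ζ hζ] at h
        exact lt_irrefl _ h
      · rw [← hζt] at h
        exact h (hF.analyticAt (hψ.exp_lt_norm (show L < ζ.re by rw [hζ]; exact hL')))
    have hbdd : Bornology.IsBounded (γ '' Ici 0) := by
      have h1 := htend.eventually (Metric.ball_mem_nhds z one_pos)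
      obtain ⟨T, -, hT⟩ := (atTop_basis_Ioi.comap Complex.re).eventually_iff.mp h1
      refine ((hψ.isBounded_image_strip hp hper (b := T) hL').union
        (Metric.isBounded_ball (x := z) (r := 1))).subset ?_
      refine hγV.trans ?_
      rintro _ (⟨ζ, hζ, rfl⟩ | hy)
      · rcases le_or_gt ζ.re T with h | h
        · exact Or.inl ⟨ζ, ⟨le_of_lt hζ, h⟩, rfl⟩
        · exact Or.inr (hT h)
      · rw [mem_singleton_iff] at hy
        rw [hy]
        exact Or.inr (Metric.mem_ball_self one_pos)
    have hcl := hbdd.isCompact_closure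
    obtain ⟨t, h1, h2⟩ := ((hγlim.eventually hcl.compl_mem_cocompact).and
      (eventually_ge_atTop 0)).exists
    exact h1 (subset_closure ⟨t, h2, rfl⟩)

end IsLogInverse
end SingularValues

end

/-! ### Harnack's inequality and the sub-mean value property on the tract -/

section
open Filter Topology Set
open scoped Real ComplexConjugate

namespace SingularValues

/-- Continuous functions on a circle are uniform limits of real parts of polynomials. -/
theorem exists_polynomial_re_approx {u : ℂ → ℝ} {ρ : ℝ} (hρ : 0 < ρ)
    (hu : ContinuousOn u (Metric.sphere 0 ρ)) {δ : ℝ} (hδ : 0 < δ) :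
    ∃ p : Polynomial ℂ, ∀ z ∈ Metric.sphere (0 : ℂ) ρ, |u z - (p.eval z).re| < δ := by
  have hmem : ∀ x : UnitAddCircle, (ρ : ℂ) * (x.toCircle : ℂ) ∈ Metric.sphere (0 : ℂ) ρ :=
    fun x => by
      rw [mem_sphere_zero_iff_norm, norm_mul, Complex.norm_real, Real.norm_of_nonneg hρ.le]
      exact (congrArg (ρ * ·) (Circle.norm_coe x.toCircle)).trans (mul_one ρ)
  let v : C(UnitAddCircle, ℂ) := ⟨fun x => (u (ρ * (x.toCircle : ℂ)) : ℂ),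
    Complex.continuous_ofReal.comp (hu.comp_continuous
      (continuous_const.mul (continuous_subtype_val.comp AddCircle.continuous_toCircle)) hmem)⟩
  -- On the circle a trigonometric polynomial has the form P + conj Q, whose real part is that of
  -- the polynomial P + Q.
  have hspan : ∀ τ ∈ Submodule.span ℂ (range (fourier (T := (1 : ℝ)))), ∃ P Q : Polynomial ℂ,
      ∀ x : UnitAddCircle, τ x = P.eval (x.toCircle : ℂ) + conj (Q.eval (x.toCircle : ℂ)) := by
    intro τ hτ
    induction hτ using Submodule.span_induction with
    | mem τ h =>
      obtain ⟨n, rfl⟩ := h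
      rcases n with n | n
      · refine ⟨Polynomial.X ^ n, 0, fun x => ?_⟩
        rw [fourier_apply, AddCircle.toCircle_zsmul]
        simp
      · refine ⟨0, Polynomial.X ^ (n + 1), fun x => ?_⟩
        rw [fourier_apply, AddCircle.toCircle_zsmul, zpow_negSucc]
        simp only [Polynomial.eval_zero, Polynomial.eval_pow, Polynomial.eval_X, zero_add,
          Circle.coe_inv, Circle.coe_pow, map_pow]
        rw [← Circle.coe_inv_eq_conj, Circle.coe_inv, inv_pow]
    | zero => exact ⟨0, 0, fun x => by simp⟩
    | add a b _ _ ha hb =>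
      obtain ⟨P, Q, h1⟩ := ha
      obtain ⟨P', Q', h2⟩ := hb
      refine ⟨P + P', Q + Q', fun x => ?_⟩
      simp only [ContinuousMap.add_apply, h1, h2, Polynomial.eval_add, map_add]
      ring
    | smul c a _ ha =>
      obtain ⟨P, Q, h1⟩ := ha
      refine ⟨Polynomial.C c * P, Polynomial.C (conj c) * Q, fun x => ?_⟩
      simp only [ContinuousMap.smul_apply, h1, Polynomial.eval_mul, Polynomial.eval_C, map_mul,
        Complex.conj_conj, smul_eq_mul]
      ring
  have hv : v ∈ (Submodule.span ℂ (range (fourier (T := (1 : ℝ))))).topologicalClosure := by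
    rw [span_fourier_closure_eq_top]; trivial
  obtain ⟨τ, hτ, hdist⟩ := Metric.mem_closure_iff.mp hv δ hδ
  obtain ⟨P, Q, hPQ⟩ := hspan τ hτ
  refine ⟨(P + Q).comp (Polynomial.C ((ρ : ℂ)⁻¹) * Polynomial.X), fun z hz => ?_⟩
  have hz' : ‖z‖ = ρ := by simpa using hz
  have hρ0 : (ρ : ℂ) ≠ 0 := by exact_mod_cast hρ.ne'
  obtain ⟨x, hx⟩ := (AddCircle.homeomorphCircle (one_ne_zero (α := ℝ))).surjective
    ⟨(ρ : ℂ)⁻¹ * z, by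
      rw [Submonoid.unitSphere, ← SetLike.mem_coe]
      simp [hz', abs_of_pos hρ, hρ.ne']⟩
  rw [AddCircle.homeomorphCircle_apply] at hx
  have hxz : (x.toCircle : ℂ) = (ρ : ℂ)⁻¹ * z := by rw [hx]
  have h1 := (ContinuousMap.dist_apply_le_dist x).trans_lt hdist
  rw [hPQ x, dist_eq_norm] at h1
  have hvx : v x = (u z : ℂ) := by
    change ((u (ρ * (x.toCircle : ℂ)) : ℝ) : ℂ) = u z
    rw [hxz, mul_inv_cancel_left₀ hρ0]
  rw [hvx, hxz] at h1
  have h2 := (Complex.abs_re_le_norm _).trans_lt h1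
  simpa [Polynomial.eval_comp] using h2

/-- **Harnack's inequality**. -/
theorem re_eval_nonneg_and_le_three_mul_circleAverage (p : Polynomial ℂ) {ρ : ℝ}
    (hp : ∀ z ∈ Metric.sphere (0 : ℂ) ρ, 0 ≤ (p.eval z).re) {w : ℂ}
    (hw : ‖w‖ < ρ) : 0 ≤ (p.eval w).re ∧
      (‖w‖ ≤ ρ / 2 → (p.eval w).re ≤ 3 * Real.circleAverage (fun z => (p.eval z).re) 0 ρ) := by
  have hρ : 0 < ρ := (norm_nonneg w).trans_lt hw
  have hwb : w ∈ Metric.ball (0 : ℂ) ρ := mem_ball_zero_iff.mpr hw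
  have hne : ∀ z ∈ Metric.sphere (0 : ℂ) ρ, z - w ≠ 0 := by
    intro z hz h
    rw [sub_eq_zero] at h
    rw [mem_sphere_zero_iff_norm, h] at hz
    exact hw.ne hz
  have hkc : ContinuousOn (fun z => ((z + w) / (z - w)).re) (Metric.sphere 0 ρ) :=
    Complex.continuous_re.comp_continuousOn
      (ContinuousOn.div (by fun_prop) (by fun_prop) hne)
  have hform := DiffContOnCl.circleAverage_re_herglotzRieszKernel_smul'
    (p.differentiable.diffContOnCl (s := Metric.ball 0 ρ)) hwb
  simp only [sub_zero] at hform
  have hint : CircleIntegrable (fun z => ((z + w) / (z - w)).re • p.eval z) 0 ρ :=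
    (hkc.smul p.continuous.continuousOn).circleIntegrable hρ.le
  have hre := Complex.reCLM.circleAverage_comp_comm hint
  rw [hform] at hre
  have hre' : Real.circleAverage (fun z => ((z + w) / (z - w)).re * (p.eval z).re) 0 ρ =
      (p.eval w).re := by
    rw [← Complex.reCLM_apply, ← hre]
    congr 1
    ext z
    simp
  have hpc : ContinuousOn (fun z => (p.eval z).re) (Metric.sphere 0 ρ) :=
    (Complex.continuous_re.comp p.continuous).continuousOn
  constructor
  · rw [← hre']
    refine Real.circleAverage_nonneg_of_nonneg fun z hz => ?_
    rw [abs_of_pos hρ] at hz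
    have h1 := le_re_herglotzRieszKernel hz hwb
    simp only [sub_zero] at h1
    have h2 : 0 ≤ (ρ - ‖w‖) / (ρ + ‖w‖) :=
      div_nonneg (by linarith) (by linarith [norm_nonneg w])
    exact mul_nonneg (h2.trans h1) (hp z hz)
  · intro hw2
    rw [← hre', ← smul_eq_mul (3 : ℝ), ← Real.circleAverage_fun_smul]
    refine Real.circleAverage_mono ((hkc.mul hpc).circleIntegrable hρ.le)
      ((hpc.const_smul (3 : ℝ)).circleIntegrable hρ.le) fun z hz => ?_
    rw [abs_of_pos hρ] at hz
    have h1 := re_herglotzRieszKernel_le hz hwb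
    simp only [sub_zero] at h1
    -- For |w| ≤ ρ/2 the Poisson kernel is at most (3ρ/2)/(ρ/2) = 3.
    have h2 : (ρ + ‖w‖) / (ρ - ‖w‖) ≤ 3 := by
      rw [div_le_iff₀ (by linarith)]
      linarith
    exact mul_le_mul_of_nonneg_right (h1.trans h2) (hp z hz)

/-- The positive harmonic function `log |F| - L'` on the tract `ψ(Re ζ > L')`, extended by zero. -/
noncomputable def tractLog (F ψ : ℂ → ℂ) (L' : ℝ) (z : ℂ) : ℝ :=
  open Classical in if z ∈ ψ '' rightHalfPlane L' then Real.log ‖F z‖ - L' else 0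

namespace IsLogInverse

variable {F ψ : ℂ → ℂ} {L : ℝ} (hψ : IsLogInverse F L ψ) (hF : UnramifiedAbove F L)
include hψ

theorem tractLog_apply {L' : ℝ} (hL' : L < L') {ζ : ℂ} (hζ : L' ≤ ζ.re) :
    tractLog F ψ L' (ψ ζ) = Real.log ‖F (ψ ζ)‖ - L' := by
  by_cases h : ψ ζ ∈ ψ '' rightHalfPlane L'
  · simp [tractLog, h]
  · have : ζ.re = L' := (hζ.eq_of_not_lt fun hlt => h ⟨ζ, hlt, rfl⟩).symm
    rw [tractLog, if_neg h, hψ.norm_eq (lt_of_lt_of_le hL' hζ), Real.log_exp, this, sub_self]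

theorem tractLog_nonneg {L' : ℝ} (hL' : L < L') (z : ℂ) : 0 ≤ tractLog F ψ L' z := by
  by_cases h : z ∈ ψ '' rightHalfPlane L'
  · obtain ⟨ζ, hζ, rfl⟩ := h
    have hζ' : L' < ζ.re := hζ
    rw [hψ.tractLog_apply hL' hζ'.le, hψ.norm_eq (hL'.trans hζ'), Real.log_exp]
    linarith
  · rw [tractLog, if_neg h]

include hF

/-- Since ψ → ∞ as Re ζ → ∞, no pole lies in the closure of the tract. -/
theorem closure_tract_subset (htend : Tendsto ψ (comap Complex.re atTop) (cocompact ℂ))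
    {L' : ℝ} (hL' : L < L') :
    closure (ψ '' rightHalfPlane L') ⊆ ψ '' {ζ | L' ≤ ζ.re} := by
  intro z hz
  have hcl : z ∈ closure (ψ '' {ζ | L' ≤ ζ.re}) :=
    closure_mono (image_mono (show rightHalfPlane L' ⊆ {ζ | L' ≤ ζ.re} from
      fun ζ hζ => le_of_lt (show L' < ζ.re from hζ))) hz
  by_cases han : AnalyticAt ℂ F z
  · exact hψ.mem_image_of_mem_closure hF hL' hcl han
  · exact absurd (hψ.mapClusterPt_of_mem_closure hF hL' hcl han)
      (not_mapClusterPt_of_tendsto_cocompact htend z)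

/-- The frontier is contained in the image of Re ζ = L', where log|F| - L' vanishes and so matches
the extension by zero. -/
theorem continuous_tractLog (htend : Tendsto ψ (comap Complex.re atTop) (cocompact ℂ))
    {L' : ℝ} (hL' : L < L') : Continuous (tractLog F ψ L') := by
  classical
  have hsub := hψ.closure_tract_subset hF htend hL'
  have heq : tractLog F ψ L' =
      fun z => if z ∈ ψ '' rightHalfPlane L' then Real.log ‖F z‖ - L' else 0 := by
    ext z; simp [tractLog]
  rw [heq]
  refine continuous_if ?_ ?_ continuousOn_const
  · intro z hz
    rcases hψ.frontier_image_subset hF hL' hz with ⟨ζ, hζ, rfl⟩ | ⟨-, h⟩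
    · rw [hψ.norm_eq (show L < ζ.re by rw [hζ]; exact hL'), Real.log_exp, hζ, sub_self]
    · exact absurd h (not_mapClusterPt_of_tendsto_cocompact htend z)
  · intro z hz
    obtain ⟨ζ, hζ, rfl⟩ := hsub hz
    have hζL : ζ ∈ rightHalfPlane L := lt_of_lt_of_le hL' hζ
    have h1 := (hF.analyticAt (hψ.exp_lt_norm hζL)).continuousAt.norm.log
      (norm_ne_zero_iff.mpr (hψ.ne_zero hζL))
    exact (h1.sub continuousAt_const).continuousWithinAt

/-- The sub-mean value inequality, with Harnack's constant. -/
theorem re_sub_le_three_mul_circleAverage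
    (htend : Tendsto ψ (comap Complex.re atTop) (cocompact ℂ)) {L' : ℝ} (hL' : L < L')
    {ρ : ℝ} (hρ : 0 < ρ) {ζ : ℂ} (hζ : ζ ∈ rightHalfPlane L') (hζρ : ‖ψ ζ‖ ≤ ρ / 2) :
    ζ.re - L' ≤ 3 * Real.circleAverage (tractLog F ψ L') 0 ρ := by
  have hu := hψ.continuous_tractLog hF htend hL'
  have hsub := hψ.closure_tract_subset hF htend hL'
  refine le_of_forall_pos_le_add fun ε hε => ?_
  -- Re p plays the part of the harmonic majorant: shifting an ε/6-approximation up by ε/6 gives u ≤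
  -- Re p ≤ u + ε/3 on the circle, and Harnack's factor 3 returns ε.
  obtain ⟨p₀, hp₀⟩ := exists_polynomial_re_approx hρ hu.continuousOn (show 0 < ε / 6 by positivity)
  set p : Polynomial ℂ := p₀ + Polynomial.C ((ε / 6 : ℝ) : ℂ) with hp
  have hpre : ∀ z, (p.eval z).re = (p₀.eval z).re + ε / 6 := fun z => by
    rw [hp, Polynomial.eval_add, Polynomial.eval_C, Complex.add_re, Complex.ofReal_re]
  have hlow : ∀ z ∈ Metric.sphere (0 : ℂ) ρ, tractLog F ψ L' z ≤ (p.eval z).re := fun z hz => by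
    rw [hpre]; linarith [(abs_lt.mp (hp₀ z hz)).2]
  have hupp : ∀ z ∈ Metric.sphere (0 : ℂ) ρ, (p.eval z).re ≤ tractLog F ψ L' z + ε / 3 :=
    fun z hz => by rw [hpre]; linarith [(abs_lt.mp (hp₀ z hz)).1]
  have hnn : ∀ z ∈ Metric.sphere (0 : ℂ) ρ, 0 ≤ (p.eval z).re := fun z hz =>
    (hψ.tractLog_nonneg hL' z).trans (hlow z hz)
  have hopen : IsOpen (ψ '' rightHalfPlane L') :=
    hψ.isOpen_image hF (isOpen_rightHalfPlane L') (rightHalfPlane_subset hL'.le)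
  set Ω : Set ℂ := ψ '' rightHalfPlane L' ∩ Metric.ball 0 ρ with hΩ
  have hΩopen : IsOpen Ω := hopen.inter Metric.isOpen_ball
  have hclΩ : ∀ z ∈ closure Ω, ‖z‖ ≤ ρ ∧ ∃ ξ : ℂ, L' ≤ ξ.re ∧ ψ ξ = z := fun z hz => by
    refine ⟨?_, hsub (closure_mono inter_subset_left hz)⟩
    exact mem_closedBall_zero_iff.mp (Metric.closure_ball_subset_closedBall
      (closure_mono inter_subset_right hz))
  -- As log|G| = log|F| - L' - Re p, the maximum modulus principle for G compares u with Re p on the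
  -- tract.
  set G : ℂ → ℂ := fun z => F z * Complex.exp (-(L' + p.eval z)) with hG
  have hGan : ∀ z ∈ closure Ω, DifferentiableAt ℂ G z := by
    intro z hz
    obtain ⟨-, ξ, hξ, rfl⟩ := hclΩ z hz
    have h1 := (hF.analyticAt (hψ.exp_lt_norm
      (show ξ ∈ rightHalfPlane L from lt_of_lt_of_le hL' hξ))).differentiableAt
    have h2 : Differentiable ℂ fun z => Complex.exp (-(L' + p.eval z)) :=
      ((p.differentiable.const_add (L' : ℂ)).neg).cexp
    exact h1.mul (h2 _)
  have hGnorm : ∀ ξ : ℂ, L' ≤ ξ.re →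
      ‖G (ψ ξ)‖ = Real.exp (ξ.re - L' - (p.eval (ψ ξ)).re) := fun ξ hξ => by
    rw [hG]
    simp only [norm_mul, Complex.norm_exp, hψ.norm_eq
      (show ξ ∈ rightHalfPlane L from lt_of_lt_of_le hL' hξ), ← Real.exp_add]
    congr 1
    simp only [Complex.neg_re, Complex.add_re, Complex.ofReal_re]
    ring
  have hmax : ‖G (ψ ζ)‖ ≤ 1 := by
    refine Complex.norm_le_of_forall_mem_frontier_norm_le (U := Ω)
      (Metric.isBounded_ball.subset inter_subset_right)
      ⟨fun z hz => (hGan z (subset_closure hz)).differentiableWithinAt,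
        fun z hz => (hGan z hz).continuousAt.continuousWithinAt⟩ ?_
      (subset_closure ⟨⟨ζ, hζ, rfl⟩, mem_ball_zero_iff.mpr (by linarith)⟩)
    intro z hz
    rw [hΩopen.frontier_eq] at hz
    obtain ⟨hzρ, ξ, hξ, rfl⟩ := hclΩ z hz.1
    rw [hGnorm ξ hξ, Real.exp_le_one_iff]
    -- On the circle Re p dominates u; on the rest of the frontier u = 0 and Re p ≥ 0.
    by_cases hsph : ‖ψ ξ‖ = ρ
    · have h1 := hlow _ (mem_sphere_zero_iff_norm.mpr hsph)
      rw [hψ.tractLog_apply hL' hξ, hψ.norm_eq (lt_of_lt_of_le hL' hξ), Real.log_exp] at h1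
      linarith
    · have hlt : ‖ψ ξ‖ < ρ := lt_of_le_of_ne hzρ hsph
      have h1 := (re_eval_nonneg_and_le_three_mul_circleAverage p hnn hlt).1
      have h2 : ξ.re = L' := (hξ.eq_of_not_lt fun h =>
        hz.2 ⟨⟨ξ, h, rfl⟩, mem_ball_zero_iff.mpr hlt⟩).symm
      linarith
  have hζ' : L' < ζ.re := hζ
  rw [hGnorm ζ hζ'.le, Real.exp_le_one_iff] at hmax
  have h3 := (re_eval_nonneg_and_le_three_mul_circleAverage p hnn
    (show ‖ψ ζ‖ < ρ by linarith)).2 hζρ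
  have h4 : Real.circleAverage (fun z => (p.eval z).re) 0 ρ ≤
      Real.circleAverage (tractLog F ψ L') 0 ρ + ε / 3 := by
    have h5 := Real.circleAverage_fun_add (c := 0) (R := ρ) (f₁ := tractLog F ψ L')
      (f₂ := fun _ => ε / 3) (hu.continuousOn.circleIntegrable hρ.le)
      (continuousOn_const.circleIntegrable hρ.le)
    rw [Real.circleAverage_const] at h5
    rw [← h5]
    refine Real.circleAverage_mono
      ((Complex.continuous_re.comp p.continuous).continuousOn.circleIntegrable hρ.le)
      ((hu.add continuous_const).continuousOn.circleIntegrable hρ.le) fun z hz => ?_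
    rw [abs_of_pos hρ] at hz
    exact hupp z hz
  linarith

end IsLogInverse
end SingularValues

end

/-! ### Quadratic growth of an injective branch and the lower bound for the proximity function -/

section
open Filter Topology Set
open scoped Real

namespace SingularValues

theorem re_cayley_pos {w : ℂ} (hw : ‖w‖ < 1) : 0 < ((1 + w) / (1 - w)).re := by
  have h1 : 1 - w ≠ 0 := by
    intro h
    rw [sub_eq_zero] at h
    rw [← h, norm_one] at hw
    exact lt_irrefl _ hw
  have h2 : 0 < Complex.normSq (1 - w) := Complex.normSq_pos.mpr h1
  have h3 : ((1 + w) / (1 - w)).re = (1 - ‖w‖ ^ 2) / Complex.normSq (1 - w) := by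
    rw [Complex.div_re, ← Complex.normSq_eq_norm_sq, Complex.normSq_apply w]
    simp only [Complex.add_re, Complex.sub_re, Complex.add_im, Complex.sub_im, Complex.one_re,
      Complex.one_im]
    field_simp
    ring
  rw [h3]
  exact div_pos (by nlinarith [norm_nonneg w]) h2

namespace IsLogInverse

variable {F ψ : ℂ → ℂ} {L : ℝ} (hψ : IsLogInverse F L ψ) (hF : UnramifiedAbove F L)
include hψ hF

/-- The image of the strip L < Re ζ < L' contains a disc about p, which injectivity keeps disjoint
from the values on Re ζ > L'. The growth theorem applies to ψ - p composed with the Cayley map; the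
point L' + x corresponds to w = (x - 1)/(x + 1), and 1 - |w| = 2/(1 + x) gives the exponent 2. -/
theorem exists_norm_le_sq (hinj : InjOn ψ (rightHalfPlane L)) {L' : ℝ} (hL' : L < L') :
    ∃ C : ℝ, 0 < C ∧ ∀ x : ℝ, 1 ≤ x → ‖ψ (L' + x : ℝ)‖ ≤ C * (1 + x) ^ 2 := by
  have hUopen : IsOpen (rightHalfPlane L ∩ {ζ : ℂ | ζ.re < L'}) :=
    (isOpen_rightHalfPlane L).inter (isOpen_lt Complex.continuous_re continuous_const)
  have himg := hψ.isOpen_image hF hUopen inter_subset_left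
  set p := ψ (((L + L') / 2 : ℝ) : ℂ) with hp
  have hpmem : p ∈ ψ '' (rightHalfPlane L ∩ {ζ : ℂ | ζ.re < L'}) := by
    refine ⟨_, ⟨?_, ?_⟩, rfl⟩
    · change L < _
      rw [Complex.ofReal_re]; linarith
    · rw [mem_ofPred_eq, Complex.ofReal_re]; linarith
  obtain ⟨ε, hε, hball⟩ := Metric.isOpen_iff.mp himg p hpmem
  have hfar : ∀ ζ ∈ rightHalfPlane L', ε ≤ ‖ψ ζ - p‖ := by
    intro ζ hζ
    by_contra h
    obtain ⟨ξ, hξ, hξζ⟩ := hball (show ψ ζ ∈ Metric.ball p ε by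
      rw [Metric.mem_ball, dist_eq_norm]; exact not_le.mp h)
    have h1 := hinj hξ.1 (rightHalfPlane_subset hL'.le hζ) hξζ
    have h2 : ξ.re < L' := hξ.2
    rw [h1] at h2
    exact lt_asymm h2 hζ
  set c : ℂ → ℂ := fun w => L' + (1 + w) / (1 - w) with hc
  have hne : ∀ w ∈ Metric.ball (0 : ℂ) 1, 1 - w ≠ 0 := by
    intro w hw h
    rw [sub_eq_zero] at h
    rw [mem_ball_zero_iff, ← h, norm_one] at hw
    exact lt_irrefl _ hw
  have hcmem : ∀ w ∈ Metric.ball (0 : ℂ) 1, c w ∈ rightHalfPlane L' := by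
    intro w hw
    have := re_cayley_pos (mem_ball_zero_iff.mp hw)
    change L' < (c w).re
    rw [hc]
    simp only [Complex.add_re, Complex.ofReal_re]
    linarith
  have hcd : DifferentiableOn ℂ c (Metric.ball 0 1) := fun w hw =>
    ((DifferentiableAt.div (by fun_prop) (by fun_prop) (hne w hw)).const_add
      (L' : ℂ)).differentiableWithinAt
  have hsubL : rightHalfPlane L' ⊆ rightHalfPlane L := rightHalfPlane_subset hL'.le
  have hfd : DifferentiableOn ℂ (fun w => ψ (c w) - p) (Metric.ball 0 1) :=
    ((hψ.differentiableOn hF).comp hcd fun w hw => hsubL (hcmem w hw)).sub_const p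
  have hfinj : InjOn (fun w => ψ (c w) - p) (Metric.ball 0 1) := by
    intro w hw v hv h
    have h1 := hinj (hsubL (hcmem w hw)) (hsubL (hcmem v hv)) (sub_left_injective h)
    have h2 : (1 + w) / (1 - w) = (1 + v) / (1 - v) := add_left_cancel h1
    rw [div_eq_div_iff (hne w hw) (hne v hv)] at h2
    linear_combination h2 / 2
  have hgrow := fun (w : ℂ) (hw : ‖w‖ < 1) => norm_le_of_injOn_ball hfd hfinj (half_pos hε)
    (fun z hz => by linarith [hfar _ (hcmem z hz)]) hw
  set A := 32 * ‖ψ (c 0) - p‖ ^ 2 / (ε / 2) with hA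
  have hA0 : 0 ≤ A := by positivity
  refine ⟨A + ‖p‖ + 1, by positivity, fun x hx => ?_⟩
  set w : ℂ := (((x - 1) / (x + 1) : ℝ) : ℂ) with hw
  have hx1 : 0 < x + 1 := by linarith
  have hwn : ‖w‖ = (x - 1) / (x + 1) := by
    rw [hw, Complex.norm_real, Real.norm_of_nonneg (div_nonneg (by linarith) hx1.le)]
  have hw1 : ‖w‖ < 1 := by rw [hwn, div_lt_one hx1]; linarith
  have hcw : c w = ((L' + x : ℝ) : ℂ) := by
    have h1 : (1 + (x - 1) / (x + 1)) / (1 - (x - 1) / (x + 1)) = x := by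
      field_simp
      ring
    rw [hc, hw]
    simp only
    rw [← Complex.ofReal_one, ← Complex.ofReal_add, ← Complex.ofReal_sub, ← Complex.ofReal_div,
      h1, ← Complex.ofReal_add]
  have h1 := hgrow w hw1
  simp only [hcw] at h1
  have h2 : 1 - ‖w‖ = 2 / (1 + x) := by
    rw [hwn]
    field_simp
    ring
  have h3 : A / (1 - ‖w‖) ^ 2 = A / 4 * (1 + x) ^ 2 := by
    rw [h2]
    field_simp
    ring
  have h4 : ‖ψ ((L' + x : ℝ) : ℂ)‖ ≤ ‖ψ ((L' + x : ℝ) : ℂ) - p‖ + ‖p‖ := by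
    simpa using norm_add_le (ψ ((L' + x : ℝ) : ℂ) - p) p
  have h5 : 1 ≤ (1 + x) ^ 2 := by nlinarith
  nlinarith [norm_nonneg p, mul_le_mul_of_nonneg_left h5 (norm_nonneg p)]

/-- The growth estimate along an injective branch of the inverse of `log F`. -/
theorem exists_mul_sqrt_le_proximity (hinj : InjOn ψ (rightHalfPlane L)) (hL : 0 ≤ L) :
    ∃ c : ℝ, 0 < c ∧ ∀ᶠ r in atTop, c * √r ≤ ValueDistribution.proximity F ⊤ r := by
  have htend := hψ.tendsto_cocompact_of_injOn hF hinj
  set L' := L + 1 with hL'def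
  have hL' : L < L' := by linarith
  obtain ⟨C, hC, hgrow⟩ := hψ.exists_norm_le_sq hF hinj hL'
  have hmer : Meromorphic F := fun z => (hF.normalForm z).meromorphicAt
  have hu := hψ.continuous_tractLog hF htend hL'
  set N : ℝ → ℝ := fun x => ‖ψ ((L' + x : ℝ) : ℂ)‖ with hN
  have hNc : ContinuousOn N (Ici 1) := by
    refine (hψ.continuousOn.comp (by fun_prop) fun x hx => ?_).norm
    change L < _
    rw [Complex.ofReal_re]
    linarith [mem_Ici.mp hx]
  have hNtop : Tendsto N atTop atTop := by
    have h1 : Tendsto (fun x : ℝ => ((L' + x : ℝ) : ℂ)) atTop (comap Complex.re atTop) := by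
      rw [tendsto_comap_iff]
      exact tendsto_atTop_add_const_left atTop L' tendsto_id
    exact (tendsto_norm_cocompact_atTop (E := ℂ)).comp (htend.comp h1)
  -- From √r ≤ √(2C)(1 + x) and 2√(2C) ≤ √r follows √r/2 ≤ √(2C)x, and x ≤ 3P supplies the remaining
  -- factor 3.
  refine ⟨1 / (6 * √(2 * C)), by positivity, ?_⟩
  filter_upwards [eventually_ge_atTop (2 * N 1), eventually_ge_atTop (8 * C),
    eventually_gt_atTop 0] with r hr1 hr2 hr0
  obtain ⟨b, hb1, hb⟩ := ((eventually_ge_atTop 1).and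
    (hNtop.eventually_ge_atTop (r / 2))).exists
  -- The modulus tends to infinity along the ray, so some x satisfies |ψ(L' + x)| = r/2.
  obtain ⟨x, hx, hxN⟩ := intermediate_value_Icc hb1
    (hNc.mono fun y hy => hy.1) (show r / 2 ∈ Icc (N 1) (N b) from ⟨by linarith, hb⟩)
  have hx1 : 1 ≤ x := hx.1
  have hmem : ((L' + x : ℝ) : ℂ) ∈ rightHalfPlane L' := by
    change L' < _
    rw [Complex.ofReal_re]; linarith
  have h1 := hψ.re_sub_le_three_mul_circleAverage hF htend hL' hr0 hmem hxN.le
  rw [Complex.ofReal_re, add_sub_cancel_left] at h1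
  have h2 : Real.circleAverage (tractLog F ψ L') 0 r ≤ ValueDistribution.proximity F ⊤ r := by
    rw [ValueDistribution.proximity_top]
    refine Real.circleAverage_mono (hu.continuousOn.circleIntegrable hr0.le)
      hmer.meromorphicOn.circleIntegrable_posLog_norm fun z _ => ?_
    by_cases hz : z ∈ ψ '' rightHalfPlane L'
    · rw [tractLog, if_pos hz]
      have : Real.log ‖F z‖ ≤ Real.posLog ‖F z‖ := le_max_right _ _
      linarith
    · rw [tractLog, if_neg hz]
      exact Real.posLog_nonneg
  set P := ValueDistribution.proximity F ⊤ r
  have h3 : r ≤ 2 * C * (1 + x) ^ 2 := by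
    have := hgrow x hx1
    rw [show ‖ψ ((L' + x : ℝ) : ℂ)‖ = r / 2 from hxN] at this
    linarith
  have h4 : √r ≤ √(2 * C) * (1 + x) := by
    rw [← Real.sqrt_sq (show 0 ≤ 1 + x by linarith), ← Real.sqrt_mul (by positivity)]
    exact Real.sqrt_le_sqrt h3
  have h5 : 2 * √(2 * C) ≤ √r := by
    refine Real.le_sqrt_of_sq_le ?_
    rw [mul_pow, Real.sq_sqrt (by positivity)]
    linarith
  have h6 : 0 < √(2 * C) := by positivity
  rw [div_mul_eq_mul_div, one_mul, div_le_iff₀ (by positivity)]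
  nlinarith

end IsLogInverse

/-- An entire function of polynomial growth is a polynomial. -/
theorem exists_polynomial_of_norm_le {E : ℂ → ℂ} (hE : Differentiable ℂ E) {C : ℝ} {N : ℕ}
    (hb : ∀ z, ‖E z‖ ≤ C * (1 + ‖z‖) ^ N) : ∃ P : Polynomial ℂ, ∀ z, E z = P.eval z := by
  induction N generalizing E C with
  | zero =>
    refine ⟨Polynomial.C (E 0), fun z => ?_⟩
    rw [Polynomial.eval_C]
    refine hE.apply_eq_apply_of_bounded ?_ z 0
    rw [isBounded_iff_forall_norm_le]
    refine ⟨C, ?_⟩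
    rintro _ ⟨w, rfl⟩
    simpa using hb w
  | succ N ih =>
    -- The difference quotient (E z - E 0)/z is entire with growth exponent lower by one; M bounds
    -- it on the unit disc.
    have hd : Differentiable ℂ (dslope E 0) := by
      rw [← differentiableOn_univ, Complex.differentiableOn_dslope univ_mem]
      exact hE.differentiableOn
    obtain ⟨M, hM⟩ := (isCompact_closedBall (0 : ℂ) 1).exists_bound_of_continuousOn
      hd.continuous.continuousOn
    have hM0 : 0 ≤ M := (norm_nonneg _).trans (hM 0 (by simp))
    have hC0 : 0 ≤ C := by
      have := (norm_nonneg _).trans (hb 0)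
      simpa using this
    obtain ⟨P, hP⟩ := ih hd (C := 4 * C + M) fun z => by
      have hpow : (1 : ℝ) ≤ (1 + ‖z‖) ^ N := one_le_pow₀ (by linarith [norm_nonneg z])
      rcases le_or_gt ‖z‖ 1 with hz | hz
      · have h1 := hM z (by simpa using hz)
        nlinarith
      · have hz0 : z ≠ 0 := norm_pos_iff.mp (one_pos.trans hz)
        have hzp : 0 < ‖z‖ := one_pos.trans hz
        rw [dslope_of_ne _ hz0, slope_def_field, norm_div, sub_zero, div_le_iff₀ hzp]
        have h1 := norm_sub_le (E z) (E 0)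
        have h2 := hb z
        have h3 := hb 0
        simp only [norm_zero, add_zero, one_pow, mul_one] at h3
        have h4 : C * (1 + ‖z‖) ^ (N + 1) ≤ 2 * C * (1 + ‖z‖) ^ N * ‖z‖ := by
          rw [pow_succ]
          have : 0 ≤ C * (1 + ‖z‖) ^ N := by positivity
          nlinarith
        have h5 : C ≤ 2 * C * (1 + ‖z‖) ^ N * ‖z‖ := by
          have : 1 ≤ (1 + ‖z‖) ^ N * ‖z‖ := one_le_mul_of_one_le_of_one_le hpow hz.le
          nlinarith
        have h6 : 0 ≤ M * (1 + ‖z‖) ^ N * ‖z‖ := by positivity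
        nlinarith
    refine ⟨Polynomial.C (E 0) + Polynomial.X * P, fun z => ?_⟩
    rw [Polynomial.eval_add, Polynomial.eval_C, Polynomial.eval_mul, Polynomial.eval_X, ← hP]
    have := sub_smul_dslope E 0 z
    rw [sub_zero, smul_eq_mul] at this
    rw [this]
    ring

end SingularValues

end

/-! ### Rationality of functions bounded away from zero near infinity -/

section
open Filter Topology Set
open scoped Real

namespace SingularValues

theorem eventually_nhdsNE_of_codiscrete {P : ℂ → Prop} (h : ∀ᶠ z in codiscrete ℂ, P z) (z : ℂ) :
    ∀ᶠ y in 𝓝[≠] z, P y := by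
  have := mem_codiscrete.mp h z
  rwa [disjoint_principal_right, compl_compl] at this

theorem eval_ne_zero_codiscrete {p : Polynomial ℂ} (hp : p ≠ 0) :
    ∀ᶠ z in codiscrete ℂ, p.eval z ≠ 0 := by
  obtain ⟨x, hx⟩ : ∃ x, p.eval x ≠ 0 := by
    by_contra! h
    exact hp (Polynomial.funext fun x => by simpa using h x)
  exact AnalyticOnNhd.preimage_zero_mem_codiscrete (f := fun z => p.eval z)
    (fun z _ => p.differentiable.analyticAt z) hx

theorem exists_prod_zpow_eq_div (s : Finset ℂ) (d : ℂ → ℤ) : ∃ p q : Polynomial ℂ, q ≠ 0 ∧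
    ∀ z, ∏ u ∈ s, (z - u) ^ d u = p.eval z / q.eval z := by
  have hfac : ∀ u : ℂ, ∃ p q : Polynomial ℂ, q ≠ 0 ∧
      ∀ z, (z - u) ^ d u = p.eval z / q.eval z := by
    intro u
    rcases (d u).eq_nat_or_neg with ⟨n, hn | hn⟩
    · exact ⟨(Polynomial.X - Polynomial.C u) ^ n, 1, one_ne_zero, fun z => by simp [hn]⟩
    · exact ⟨1, (Polynomial.X - Polynomial.C u) ^ n,
        pow_ne_zero _ (Polynomial.X_sub_C_ne_zero u), fun z => by simp [hn]⟩
  choose p q hq hpq using hfac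
  refine ⟨∏ u ∈ s, p u, ∏ u ∈ s, q u, Finset.prod_ne_zero_iff.mpr fun u _ => hq u, fun z => ?_⟩
  rw [Polynomial.eval_prod, Polynomial.eval_prod, ← Finset.prod_div_distrib]
  exact Finset.prod_congr rfl fun u _ => hpq u z

/-- Distance at least 1 from every u allows negative exponents to be replaced by their absolute
values. -/
theorem norm_prod_zpow_le (s : Finset ℂ) (d : ℂ → ℤ) : ∃ C : ℝ, 0 ≤ C ∧ ∃ N : ℕ, ∀ z : ℂ,
    (∀ u ∈ s, 1 ≤ ‖z - u‖) → ‖∏ u ∈ s, (z - u) ^ d u‖ ≤ C * (1 + ‖z‖) ^ N := by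
  refine ⟨∏ u ∈ s, (1 + ‖u‖) ^ (d u).natAbs, Finset.prod_nonneg fun u _ => by positivity,
    ∑ u ∈ s, (d u).natAbs, fun z hz => ?_⟩
  rw [norm_prod, ← Finset.prod_pow_eq_pow_sum, ← Finset.prod_mul_distrib]
  refine Finset.prod_le_prod (fun u _ => norm_nonneg _) fun u hu => ?_
  rw [norm_zpow, ← mul_pow]
  calc ‖z - u‖ ^ d u ≤ ‖z - u‖ ^ ((d u).natAbs : ℤ) :=
        zpow_le_zpow_right₀ (hz u hu) Int.le_natAbs
    _ = ‖z - u‖ ^ (d u).natAbs := zpow_natCast _ _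
    _ ≤ _ := by
        refine pow_le_pow_left₀ (norm_nonneg _) ?_ _
        have := norm_sub_le z u
        nlinarith [norm_nonneg z, norm_nonneg u]

/-- A meromorphic function which is bounded away from zero near infinity and has no poles there is
rational. -/
theorem isRational_of_lt_norm {F : ℂ → ℂ} (hF : ∀ z, MeromorphicNFAt F z) {m K : ℝ} (hm : 0 < m)
    (hK : ∀ z, K < ‖z‖ → m < ‖F z‖) : IsRational F := by
  have hmer : MeromorphicOn F univ := fun z _ => (hF z).meromorphicAt
  have hne : ∀ z, K < ‖z‖ → F z ≠ 0 := fun z hz => norm_pos_iff.mp (hm.trans (hK z hz))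
  have hord0 : ∀ z, K < ‖z‖ → meromorphicOrderAt F z = 0 := fun z hz =>
    (hF z).meromorphicOrderAt_eq_zero_iff.mpr (hne z hz)
  have hord : ∀ u : (univ : Set ℂ), meromorphicOrderAt F u ≠ ⊤ := by
    rw [← hmer.exists_meromorphicOrderAt_ne_top_iff_forall isConnected_univ]
    have h1 : K < ‖((|K| + 1 : ℝ) : ℂ)‖ := by
      rw [Complex.norm_real, Real.norm_of_nonneg (by positivity)]
      linarith [le_abs_self K]
    refine ⟨⟨((|K| + 1 : ℝ) : ℂ), mem_univ _⟩, ?_⟩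
    rw [hord0 _ h1]
    exact WithTop.zero_ne_top
  set D := MeromorphicOn.divisor F univ with hD
  have hDK : ∀ z, D z ≠ 0 → ‖z‖ ≤ K := fun z hz => by
    by_contra h
    rw [hD, MeromorphicOn.divisor_apply hmer (mem_univ z), hord0 z (not_le.mp h)] at hz
    exact hz rfl
  have hfin : D.support.Finite := by
    have hmer' : MeromorphicOn F (Metric.closedBall 0 K) := fun z _ => (hF z).meromorphicAt
    refine ((MeromorphicOn.divisor F (Metric.closedBall 0 K)).finiteSupport
      (isCompact_closedBall 0 K)).subset fun z hz => ?_
    have hzK : z ∈ Metric.closedBall (0 : ℂ) K := mem_closedBall_zero_iff.mpr (hDK z hz)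
    have h1 : D z ≠ 0 := hz
    rw [hD, MeromorphicOn.divisor_apply hmer (mem_univ z)] at h1
    change MeromorphicOn.divisor F (Metric.closedBall 0 K) z ≠ 0
    rwa [MeromorphicOn.divisor_apply hmer' hzK]
  -- F is a finite product of zeros and poles times a zero-free entire g. The lower bound on |F|
  -- gives 1/g polynomial growth, so 1/g is a polynomial and F is rational.
  obtain ⟨g, hg, hg0, hFg⟩ := hmer.extract_zeros_poles hord hfin
  set s := hfin.toFinset with hs
  have hφ : ∀ z, (∏ᶠ u, (· - u) ^ D u) z = ∏ u ∈ s, (z - u) ^ D u := by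
    intro z
    rw [Function.FactorizedRational.finprod_eq_fun hfin]
    refine finprod_eq_prod_of_mulSupport_subset _ fun u hu => ?_
    rw [hs, Finite.coe_toFinset]
    intro h0
    exact hu (by simp [show D u = 0 from h0])
  have hFg' : ∀ᶠ z in codiscrete ℂ, F z = (∏ u ∈ s, (z - u) ^ D u) * g z := by
    filter_upwards [hFg] with z hz
    rw [hz, Pi.smul_apply', hφ, smul_eq_mul]
  have hgd : Differentiable ℂ g := fun z => (hg z (mem_univ z)).differentiableAt
  have hgne : ∀ z, g z ≠ 0 := fun z => hg0 ⟨z, mem_univ z⟩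
  have hEd : Differentiable ℂ fun z => (g z)⁻¹ := hgd.fun_inv hgne
  obtain ⟨C, hC, N, hbound⟩ := norm_prod_zpow_le s D
  obtain ⟨M, hM⟩ := (isCompact_closedBall (0 : ℂ) (K + 1)).exists_bound_of_continuousOn
    hEd.continuous.continuousOn
  have hbig : ∀ z : ℂ, K + 1 < ‖z‖ → ‖(g z)⁻¹‖ ≤ C / m * (1 + ‖z‖) ^ N := by
    intro z hz
    -- The factorization holds only off a discrete set, so the bound is proved near z and passed to
    -- the limit by continuity.
    have hev : ∀ᶠ y in 𝓝[≠] z, ‖(g y)⁻¹‖ ≤ C / m * (1 + ‖y‖) ^ N := by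
      filter_upwards [eventually_nhdsNE_of_codiscrete hFg' z, nhdsWithin_le_nhds
        ((isOpen_lt continuous_const continuous_norm).mem_nhds hz)] with y hy hyK
      have hyK' : K + 1 < ‖y‖ := hyK
      have h1 := hbound y fun u hu => by
        have h2 := hDK u (by simpa [hs] using hu)
        have h3 := norm_sub_norm_le y u
        linarith
      have h2 := hK y (by linarith)
      rw [hy, norm_mul] at h2
      have h3 : 0 < ‖g y‖ := norm_pos_iff.mpr (hgne y)
      rw [norm_inv, inv_le_iff_one_le_mul₀ h3, div_mul_eq_mul_div, div_mul_eq_mul_div,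
        one_le_div hm]
      exact h2.le.trans (mul_le_mul_of_nonneg_right h1 h3.le)
    refine le_of_tendsto_of_tendsto (b := 𝓝[≠] z) ?_ ?_ hev
    · exact (hEd.continuous.norm.tendsto z).mono_left nhdsWithin_le_nhds
    · exact Tendsto.mono_left (Continuous.tendsto (by fun_prop) z) nhdsWithin_le_nhds
  obtain ⟨P, hP⟩ := exists_polynomial_of_norm_le hEd (C := C / m + |M|) (N := N) fun z => by
    have hpow : (1 : ℝ) ≤ (1 + ‖z‖) ^ N := one_le_pow₀ (by linarith [norm_nonneg z])
    have hCm : 0 ≤ C / m := by positivity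
    rcases le_or_gt ‖z‖ (K + 1) with h | h
    · have h1 := (hM z (by simpa using h)).trans (le_abs_self M)
      nlinarith [abs_nonneg M]
    · have h1 := hbig z h
      nlinarith [abs_nonneg M]
  obtain ⟨p, q, hq, hpq⟩ := exists_prod_zpow_eq_div s D
  have hP0 : P ≠ 0 := by
    rintro rfl
    have := hP 0
    simp only [Polynomial.eval_zero, inv_eq_zero] at this
    exact hgne 0 this
  refine ⟨p, q * P, mul_ne_zero hq hP0, ?_⟩
  filter_upwards [hFg'] with z hz
  rw [hz, hpq, Polynomial.eval_mul, ← hP z]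
  have := hgne z
  field_simp

end SingularValues

end

/-! ### Reduction to the asymptotic value ∞ and conclusion -/

section
open Filter Topology Set
open scoped Real

namespace SingularValues

/-- Otherwise the curve would eventually run inside the discrete set of poles, hence be constant.
This provides a starting point on curves that may pass through poles. -/
theorem exists_analyticAt_of_tendsto_cocompact {F : ℂ → ℂ} (hF : Meromorphic F) {γ : ℝ → ℂ}
    (hγ : ContinuousOn γ (Ici 0)) (hγlim : Tendsto γ atTop (cocompact ℂ)) {t₀ : ℝ} (ht₀ : 0 ≤ t₀) :
    ∃ t, t₀ ≤ t ∧ AnalyticAt ℂ F (γ t) := by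
  by_contra! h
  have hcod : {z | AnalyticAt ℂ F z} ∈ codiscrete ℂ := by
    rw [mem_codiscrete]
    intro z
    rw [disjoint_principal_right, compl_compl]
    exact (hF z).eventually_analyticAt
  have hconst : ∀ t ∈ Ici t₀, γ t = γ t₀ := fun t ht =>
    isPreconnected_Ici.constant_of_mapsTo (mem_codiscrete'.mp hcod).2
      (hγ.mono (Ici_subset_Ici.mpr ht₀)) (fun s hs => h s hs) ht self_mem_Ici
  obtain ⟨t, ht, hle⟩ := ((hγlim.eventually
    (isCompact_singleton (x := γ t₀)).compl_mem_cocompact).and (eventually_ge_atTop t₀)).exists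
  exact ht (hconst t hle)

/-- A meromorphic function with a logarithmic singularity over infinity has proximity function at
least of order `√r`. -/
theorem UnramifiedAbove.exists_mul_sqrt_le_proximity {F : ℂ → ℂ} {L : ℝ} (hF : UnramifiedAbove F L)
    (hL : 0 ≤ L) (hrat : ¬ IsRational F) {γ : ℝ → ℂ} (hγ : ContinuousOn γ (Ici 0))
    (hγlim : Tendsto γ atTop (cocompact ℂ))
    (hγF : ∀ K, ∀ᶠ t in atTop, K < ‖F (γ t)‖ ∨ ¬ AnalyticAt ℂ F (γ t)) :
    ∃ c, 0 < c ∧ ∀ᶠ r in atTop, c * √r ≤ ValueDistribution.proximity F ⊤ r := by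
  have hsmall : ∀ K, ∃ z, K < ‖z‖ ∧ ‖F z‖ ≤ Real.exp L := by
    intro K
    by_contra! h
    exact hrat (isRational_of_lt_norm hF.normalForm (Real.exp_pos L) h)
  obtain ⟨t₀, ht₀, ht₀'⟩ := ((eventually_ge_atTop (0 : ℝ)).and
    (eventually_forall_ge_atTop.mpr (hγF (Real.exp (L + 1))))).exists
  obtain ⟨t₁, ht₁, han⟩ := exists_analyticAt_of_tendsto_cocompact
    (fun z => (hF.normalForm z).meromorphicAt) hγ hγlim ht₀
  have hbig : Real.exp (L + 1) < ‖F (γ t₁)‖ := (ht₀' t₁ ht₁).resolve_right fun h => h han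
  have hne : F (γ t₁) ≠ 0 := norm_pos_iff.mp ((Real.exp_pos _).trans hbig)
  have hζ₀ : Complex.log (F (γ t₁)) ∈ rightHalfPlane (L + 1) := by
    change L + 1 < _
    rw [Complex.log_re]
    exact (Real.lt_log_iff_exp_lt (norm_pos_iff.mpr hne)).mpr hbig
  have hLL : L < L + 1 := lt_add_one L
  obtain ⟨ψ, hψ, hψ₀⟩ := hF.exists_isLogInverse (rightHalfPlane_subset hLL.le hζ₀)
    (Complex.exp_log hne).symm
  -- The curve is restarted at t₁, where ψ takes the value γ t₁; beyond it |F| > exp(L + 1) except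
  -- at poles.
  have hinj : InjOn ψ (rightHalfPlane L) := by
    refine hψ.injOn hF hLL hsmall (γ := fun t => γ (t₁ + t)) ?_ ?_ ?_ hζ₀ (by simpa using hψ₀)
    · refine hγ.comp (by fun_prop) fun t ht => ?_
      exact add_nonneg (ht₀.trans ht₁) ht
    · exact hγlim.comp (tendsto_atTop_add_const_left _ _ tendsto_id)
    · intro t ht
      exact ht₀' _ (ht₁.trans (le_add_of_nonneg_right ht))
  exact hψ.exists_mul_sqrt_le_proximity hF hinj hL

theorem sphereMap_eq_of_tendsto {f : ℂ → ℂ} {z : ℂ} {a : OnePoint ℂ}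
    (h : Tendsto (fun w => (f w : OnePoint ℂ)) (𝓝[≠] z) (𝓝 a)) : sphereMap f z = a :=
  h.limUnder_eq

theorem sphereMap_eq_coe {f g : ℂ → ℂ} {z : ℂ} (h : f =ᶠ[𝓝[≠] z] g) (hg : ContinuousAt g z) :
    sphereMap f z = (g z : OnePoint ℂ) := by
  refine sphereMap_eq_of_tendsto ?_
  refine ((OnePoint.continuous_coe.tendsto (g z)).comp
    (hg.tendsto.mono_left nhdsWithin_le_nhds)).congr' ?_
  filter_upwards [h] with w hw
  simp [hw]

theorem sphereMap_eq_infty {f : ℂ → ℂ} {z : ℂ}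
    (h : Tendsto f (𝓝[≠] z) (Bornology.cobounded ℂ)) : sphereMap f z = OnePoint.infty := by
  refine sphereMap_eq_of_tendsto (OnePoint.tendsto_coe_infty.comp ?_)
  rwa [coclosedCompact_eq_cocompact, ← Metric.cobounded_eq_cocompact]

theorem isCriticalPoint_of_deriv_eq_zero {f g : ℂ → ℂ} {z : ℂ} (h : f =ᶠ[𝓝[≠] z] g)
    (hg : AnalyticAt ℂ g z) (hd : deriv g z = 0) : IsCriticalPoint f z := by
  refine Or.inl ⟨?_, ?_⟩
  · rw [meromorphicOrderAt_congr h]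
    exact hg.meromorphicOrderAt_nonneg
  · rw [meromorphicOrderAt_congr h.nhdsNE_deriv,
      ← tendsto_zero_iff_meromorphicOrderAt_pos hg.deriv.meromorphicAt]
    have := hg.deriv.continuousAt.tendsto
    rw [hd] at this
    exact this.mono_left nhdsWithin_le_nhds

/-- If `f = M ∘ F` with `M` holomorphic off zero, and `M` maps `exp L < |w| < ∞` into the set of
regular values of `f`, then `F` is unramified there. -/
theorem unramifiedAbove_of_notMem_singularValues {f F M : ℂ → ℂ} {L : ℝ}
    (hF : ∀ z, MeromorphicNFAt F z) (hM : ∀ w ≠ 0, AnalyticAt ℂ M w)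
    (hfF : f =ᶠ[codiscrete ℂ] fun z => M (F z))
    (hL : ∀ w : ℂ, Real.exp L < ‖w‖ → (M w : OnePoint ℂ) ∉ singularValues f) :
    UnramifiedAbove F L := by
  have hloc : ∀ z, Real.exp L < ‖F z‖ → AnalyticAt ℂ F z ∧ AnalyticAt ℂ (fun z => M (F z)) z := by
    intro z hz
    have hne : F z ≠ 0 := norm_pos_iff.mp ((Real.exp_pos _).trans hz)
    have han : AnalyticAt ℂ F z := by
      by_contra h
      exact hne (eq_zero_and_tendsto_of_not_analyticAt (hF z) h).1
    exact ⟨han, (hM _ hne).comp han⟩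
  have hsph : ∀ z, Real.exp L < ‖F z‖ → sphereMap f z = (M (F z) : OnePoint ℂ) := fun z hz =>
    sphereMap_eq_coe (eventually_nhdsNE_of_codiscrete hfF z) (hloc z hz).2.continuousAt
  refine ⟨hF, fun z hz hd => ?_, fun w γ hw hγ hγlim hlim => ?_⟩
  · refine hL _ hz (Or.inl ⟨z, ?_, hsph z hz⟩)
    refine isCriticalPoint_of_deriv_eq_zero (eventually_nhdsNE_of_codiscrete hfF z)
      (hloc z hz).2 ?_
    have hne : F z ≠ 0 := norm_pos_iff.mp ((Real.exp_pos _).trans hz)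
    have := ((hM _ hne).differentiableAt.hasDerivAt.comp z
      (hloc z hz).1.differentiableAt.hasDerivAt).deriv
    rw [hd, mul_zero] at this
    exact this
  · refine hL w hw (Or.inr ⟨γ, hγ, hγlim, ?_⟩)
    have hne : w ≠ 0 := norm_pos_iff.mp ((Real.exp_pos _).trans hw)
    refine ((OnePoint.continuous_coe.tendsto (M w)).comp
      ((hM w hne).continuousAt.tendsto.comp hlim)).congr' ?_
    filter_upwards [hlim.norm.eventually_const_lt hw] with t ht
    exact (hsph _ ht).symm

/-- This is where finiteness of the singular set enters: its preimage under an injective M is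
finite, hence bounded. -/
theorem exists_forall_exp_lt_notMem {M : ℂ → ℂ} (hM : Function.Injective M)
    {S : Set (OnePoint ℂ)} (hS : S.Finite) :
    ∃ L, 0 ≤ L ∧ ∀ w : ℂ, Real.exp L < ‖w‖ → (M w : OnePoint ℂ) ∉ S := by
  have hfin : ((fun w : ℂ => (M w : OnePoint ℂ)) ⁻¹' S).Finite :=
    hS.preimage (OnePoint.coe_injective.comp hM).injOn
  obtain ⟨B, hB⟩ := hfin.isBounded.exists_norm_le
  refine ⟨|B|, abs_nonneg B, fun w hw hwS => ?_⟩
  have h1 := hB w hwS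
  have h2 := Real.add_one_le_exp |B|
  linarith [le_abs_self B]

theorem lowerGrowth_pos {f : ℂ → ℂ} {c C : ℝ} (hc : 0 < c)
    (h : ∀ᶠ r in atTop, c * √r ≤ ValueDistribution.characteristic f ⊤ r + C) :
    0 < lowerGrowth f := by
  have h2 : (0 : EReal) < ((c / 2 : ℝ) : EReal) := by exact_mod_cast half_pos hc
  refine h2.trans_le (le_liminf_of_le (by isBoundedDefault) ?_)
  -- Once √r ≥ 2|C|/c, half of c√r absorbs the constant C.
  filter_upwards [h, eventually_gt_atTop 0,
    (Real.tendsto_sqrt_atTop.eventually_ge_atTop (2 * |C| / c))] with r hr hr0 hr1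
  have hs : 0 < √r := Real.sqrt_pos.mpr hr0
  rw [EReal.coe_le_coe_iff, le_div_iff₀ hs]
  rw [div_le_iff₀ hc] at hr1
  nlinarith [le_abs_self C]

theorem exists_mul_sqrt_le_characteristic {f F M : ℂ → ℂ} (hF : ∀ z, MeromorphicNFAt F z)
    (hM : ∀ w ≠ 0, AnalyticAt ℂ M w) (hMinj : Function.Injective M)
    (hfF : f =ᶠ[codiscrete ℂ] fun z => M (F z)) (hrat : ¬ IsRational F)
    (hfin : (singularValues f).Finite) {γ : ℝ → ℂ} (hγ : ContinuousOn γ (Ici 0))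
    (hγlim : Tendsto γ atTop (cocompact ℂ))
    (hγF : ∀ K, ∀ᶠ t in atTop, K < ‖F (γ t)‖ ∨ ¬ AnalyticAt ℂ F (γ t)) :
    ∃ c, 0 < c ∧ ∀ᶠ r in atTop, c * √r ≤ ValueDistribution.characteristic F ⊤ r := by
  obtain ⟨L, hL, hL'⟩ := exists_forall_exp_lt_notMem hMinj hfin
  obtain ⟨c, hc, h⟩ := (unramifiedAbove_of_notMem_singularValues hF hM hfF
    hL').exists_mul_sqrt_le_proximity hL hrat hγ hγlim hγF
  refine ⟨c, hc, ?_⟩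
  filter_upwards [h, eventually_ge_atTop 1] with r hr hr1
  exact hr.trans (le_add_of_nonneg_right (ValueDistribution.logCounting_nonneg hr1))

theorem eventually_nhds_infty_lt_norm (K : ℝ) :
    ∀ᶠ b : OnePoint ℂ in 𝓝 OnePoint.infty, ∀ w : ℂ, b = (w : OnePoint ℂ) → K < ‖w‖ := by
  rw [OnePoint.nhds_infty_eq, eventually_sup, eventually_map, coclosedCompact_eq_cocompact,
    ← Metric.cobounded_eq_cocompact]
  refine ⟨?_, ?_⟩
  · filter_upwards [(tendsto_norm_cobounded_atTop (E := ℂ)).eventually_gt_atTop K] with x hx w hw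
    rwa [← OnePoint.coe_injective hw]
  · exact eventually_pure.mpr fun w hw => absurd hw (OnePoint.infty_ne_coe w)

theorem eventually_nhds_coe_lt_norm (a : ℂ) (K : ℝ) :
    ∀ᶠ b in 𝓝 (a : OnePoint ℂ), b ≠ OnePoint.infty ∧
      ∀ w : ℂ, w ≠ 0 → b = ((a + w⁻¹ : ℂ) : OnePoint ℂ) → K < ‖w‖ := by
  rw [OnePoint.nhds_coe_eq, eventually_map]
  have hK : 0 < (|K| + 1)⁻¹ := by positivity
  filter_upwards [Metric.ball_mem_nhds a hK] with x hx
  refine ⟨OnePoint.coe_ne_infty x, fun w hw hxw => ?_⟩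
  rw [OnePoint.coe_injective hxw, Metric.mem_ball, dist_eq_norm, add_sub_cancel_left, norm_inv,
    inv_lt_inv₀ (norm_pos_iff.mpr hw) (by positivity)] at hx
  linarith [le_abs_self K]

theorem lowerGrowth_pos_of_isAsymptoticValue_infty {f : ℂ → ℂ} (hf : Meromorphic f)
    (hrat : ¬ IsRational f) (hfin : (singularValues f).Finite)
    (ha : IsAsymptoticValue f OnePoint.infty) : 0 < lowerGrowth f := by
  obtain ⟨γ, hγ, hγlim, hlim⟩ := ha
  have hf' : MeromorphicOn f univ := fun z _ => hf z
  set F := toMeromorphicNFOn f univ with hFdef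
  have hF : ∀ z, MeromorphicNFAt F z := fun z =>
    meromorphicNFOn_toMeromorphicNFOn f univ (mem_univ z)
  have hfF : f =ᶠ[codiscrete ℂ] F := toMeromorphicNFOn_eqOn_codiscrete hf'
  obtain ⟨c, hc, h⟩ := exists_mul_sqrt_le_characteristic (M := fun w => w) hF
    (fun w _ => analyticAt_id) Function.injective_id hfF
    (fun ⟨p, q, hq, h⟩ => hrat ⟨p, q, hq, hfF.trans h⟩) hfin hγ hγlim (fun K => by
      filter_upwards [hlim.eventually (eventually_nhds_infty_lt_norm K)] with t ht
      by_contra! hcon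
      exact (ht _ (sphereMap_eq_coe (eventually_nhdsNE_of_codiscrete hfF _)
        hcon.2.continuousAt)).not_ge hcon.1)
  refine lowerGrowth_pos (C := 0) hc ?_
  filter_upwards [h, eventually_ne_atTop 0] with r hr hr0
  rwa [ValueDistribution.characteristic_congr_codiscrete hfF hr0, add_zero]

theorem IsRational.add_inv {f F : ℂ → ℂ} {a : ℂ} (h : IsRational F)
    (hfF : f =ᶠ[codiscrete ℂ] fun z => a + (F z)⁻¹) : IsRational f := by
  obtain ⟨p, q, hq, hpq⟩ := h
  rcases eq_or_ne p 0 with rfl | hp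
  · refine ⟨Polynomial.C a, 1, one_ne_zero, ?_⟩
    filter_upwards [hfF, hpq] with z h1 h2
    simp [h1, h2]
  · refine ⟨Polynomial.C a * p + q, p, hp, ?_⟩
    filter_upwards [hfF, hpq, eval_ne_zero_codiscrete hp] with z h1 h2 h3
    simp only [h1, h2, Polynomial.eval_add, Polynomial.eval_mul, Polynomial.eval_C]
    field_simp

theorem meromorphicOrderAt_ne_top_of_not_isRational {F : ℂ → ℂ} (hF : Meromorphic F)
    (hrat : ¬ IsRational F) (z : ℂ) : meromorphicOrderAt F z ≠ ⊤ := by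
  have hF' : MeromorphicOn F univ := fun z _ => hF z
  suffices h : ∀ u : (univ : Set ℂ), meromorphicOrderAt F u ≠ ⊤ from h ⟨z, mem_univ z⟩
  rw [← hF'.exists_meromorphicOrderAt_ne_top_iff_forall isConnected_univ]
  by_contra! h
  refine hrat ⟨0, 1, one_ne_zero, ?_⟩
  simp only [Polynomial.eval_zero, zero_div]
  change {z | F z = 0} ∈ codiscrete ℂ
  rw [mem_codiscrete]
  intro z
  rw [disjoint_principal_right, compl_compl]
  exact meromorphicOrderAt_eq_top_iff.mp (h ⟨z, mem_univ z⟩)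

/-- F = 1/(f - a) has the asymptotic value ∞ along γ. The first main theorem for inverses and the
shift estimate give T(r, F) = T(r, f) + O(1). -/
theorem lowerGrowth_pos_of_isAsymptoticValue_coe {f : ℂ → ℂ} (hf : Meromorphic f)
    (hrat : ¬ IsRational f) (hfin : (singularValues f).Finite) {a : ℂ}
    (ha : IsAsymptoticValue f a) : 0 < lowerGrowth f := by
  obtain ⟨γ, hγ, hγlim, hlim⟩ := ha
  have hfa : Meromorphic (fun z => f z - a) := fun z => (hf z).fun_sub (MeromorphicAt.const a z)
  have hG : Meromorphic (fun z => f z - a)⁻¹ := fun z => (hfa z).inv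
  have hG' : MeromorphicOn (fun z => f z - a)⁻¹ univ := fun z _ => hG z
  set F := toMeromorphicNFOn (fun z => f z - a)⁻¹ univ with hFdef
  have hF : ∀ z, MeromorphicNFAt F z := fun z =>
    meromorphicNFOn_toMeromorphicNFOn _ univ (mem_univ z)
  have hGF : (fun z => f z - a)⁻¹ =ᶠ[codiscrete ℂ] F := toMeromorphicNFOn_eqOn_codiscrete hG'
  have hfF : f =ᶠ[codiscrete ℂ] fun z => a + (F z)⁻¹ := by
    filter_upwards [hGF] with z hz
    rw [← hz]
    simp
  have hFrat : ¬ IsRational F := fun h => hrat (h.add_inv hfF)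
  -- At a zero of F the expression a + (F z)⁻¹ evaluates to a, although f has a pole there; this
  -- shows that γ eventually avoids such points.
  have hpole : ∀ z, AnalyticAt ℂ F z → F z = 0 → sphereMap f z = OnePoint.infty := by
    intro z han h0
    refine sphereMap_eq_infty ?_
    have h1 : Tendsto F (𝓝[≠] z) (𝓝[≠] 0) := by
      refine tendsto_nhdsWithin_iff.mpr ⟨?_, ?_⟩
      · have := han.continuousAt.tendsto
        rw [h0] at this
        exact this.mono_left nhdsWithin_le_nhds
      · exact (meromorphicOrderAt_ne_top_iff_eventually_ne_zero han.meromorphicAt).mp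
          (meromorphicOrderAt_ne_top_of_not_isRational (fun z => (hF z).meromorphicAt) hFrat z)
    have h2 := tendsto_inv₀_nhdsNE_zero.comp h1
    refine (tendsto_const_add_cobounded a |>.comp h2).congr' ?_
    filter_upwards [eventually_nhdsNE_of_codiscrete hfF z] with y hy
    simp [hy]
  obtain ⟨c, hc, h⟩ := exists_mul_sqrt_le_characteristic (M := fun w => a + w⁻¹) hF
    -- Since 0⁻¹ = 0, the map w ↦ a + w⁻¹ is injective on all of ℂ, while analyticity is needed only
    -- for w ≠ 0.
    (fun w hw => analyticAt_const.add (analyticAt_id.inv hw))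
    (fun x y hxy => inv_injective (add_left_cancel hxy)) hfF hFrat hfin hγ hγlim (fun K => by
      filter_upwards [hlim.eventually (eventually_nhds_coe_lt_norm a K)] with t ht
      by_contra! hcon
      have hne : F (γ t) ≠ 0 := fun h0 => ht.1 (hpole _ hcon.2 h0)
      refine (ht.2 _ hne (sphereMap_eq_coe (eventually_nhdsNE_of_codiscrete hfF _)
        ?_)).not_ge hcon.1
      exact continuousAt_const.add (hcon.2.continuousAt.inv₀ hne))
  obtain ⟨C₁, hC₁⟩ : ∃ C₁, ∀ r, |ValueDistribution.characteristic (fun z => f z - a) ⊤ r -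
      ValueDistribution.characteristic (fun z => f z - a)⁻¹ ⊤ r| ≤ C₁ :=
    ⟨_, fun r => ValueDistribution.characteristic_sub_characteristic_inv_le hfa⟩
  obtain ⟨C₂, hC₂⟩ : ∃ C₂, ∀ r, |ValueDistribution.characteristic f ⊤ r -
      ValueDistribution.characteristic (fun z => f z - a) ⊤ r| ≤ C₂ :=
    ⟨_, fun r => ValueDistribution.abs_characteristic_sub_characteristic_shift_le hf⟩
  refine lowerGrowth_pos (C := C₁ + C₂) hc ?_
  filter_upwards [h, eventually_ne_atTop 0] with r hr hr0
  rw [← ValueDistribution.characteristic_congr_codiscrete hGF hr0] at hr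
  linarith [(abs_le.mp (hC₁ r)).1, (abs_le.mp (hC₂ r)).1]

/-- A transcendental entire function with finitely many singular values has the asymptotic value
infinity. -/
theorem isAsymptoticValue_infty_of_differentiable {f : ℂ → ℂ} (hf : Differentiable ℂ f)
    (hrat : ¬ IsRational f) (hfin : (singularValues f).Finite) :
    IsAsymptoticValue f OnePoint.infty := by
  have han : ∀ z, AnalyticAt ℂ f z := fun z => hf.analyticAt z
  obtain ⟨L, -, hL⟩ := exists_forall_exp_lt_notMem (M := fun w => w) Function.injective_id hfin
  have hF : UnramifiedAbove f L := unramifiedAbove_of_notMem_singularValues (M := fun w => w)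
    (fun z => (han z).meromorphicNFAt) (fun w _ => analyticAt_id) EventuallyEq.rfl hL
  -- By Liouville's theorem f is unbounded, since a constant would be rational.
  obtain ⟨z₀, hz₀⟩ : ∃ z₀, Real.exp L < ‖f z₀‖ := by
    by_contra! h
    have hb : Bornology.IsBounded (range f) := isBounded_iff_forall_norm_le.mpr
      ⟨Real.exp L, by rintro _ ⟨z, rfl⟩; exact h z⟩
    refine hrat ⟨Polynomial.C (f 0), 1, one_ne_zero, Eventually.of_forall fun z => ?_⟩
    simp [hf.apply_eq_apply_of_bounded hb z 0]
  have hne : f z₀ ≠ 0 := norm_pos_iff.mp ((Real.exp_pos _).trans hz₀)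
  set ζ₀ := Complex.log (f z₀) with hζ₀def
  have hζ₀ : L < ζ₀.re := by
    rw [hζ₀def, Complex.log_re]
    exact (Real.lt_log_iff_exp_lt (norm_pos_iff.mpr hne)).mpr hz₀
  obtain ⟨ψ, hψ, -⟩ := hF.exists_isLogInverse (ζ₀ := ζ₀) hζ₀ (Complex.exp_log hne).symm
  have hmem : ∀ t : ℝ, 0 ≤ t → ζ₀ + t ∈ rightHalfPlane L := fun t ht => by
    change L < (ζ₀ + t).re
    simp only [Complex.add_re, Complex.ofReal_re]
    linarith
  have hnorm : Tendsto (fun t : ℝ => ‖f (ψ (ζ₀ + t))‖) atTop atTop := by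
    have h1 : Tendsto (fun t : ℝ => Real.exp (ζ₀.re + t)) atTop atTop :=
      Real.tendsto_exp_atTop.comp (tendsto_atTop_add_const_left _ _ tendsto_id)
    refine h1.congr' ?_
    filter_upwards [eventually_ge_atTop 0] with t ht
    rw [hψ.map_eq _ (hmem t ht), Complex.norm_exp]
    simp
  refine ⟨fun t => ψ (ζ₀ + t), hψ.continuousOn.comp (by fun_prop) fun t ht => hmem t ht, ?_, ?_⟩
  -- An entire f is bounded on compact sets while |f| → ∞ along the curve, so the curve leaves every
  -- compact set.
  · rw [(hasBasis_cocompact (X := ℂ)).tendsto_right_iff]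
    intro K hK
    obtain ⟨B, hB⟩ := hK.exists_bound_of_continuousOn hf.continuous.continuousOn
    filter_upwards [hnorm.eventually_gt_atTop B] with t ht htK
    exact (hB _ htK).not_gt ht
  · have h1 : ∀ z, sphereMap f z = (f z : OnePoint ℂ) := fun z =>
      sphereMap_eq_coe EventuallyEq.rfl hf.continuous.continuousAt
    simp only [h1]
    refine OnePoint.tendsto_coe_infty.comp ?_
    rw [coclosedCompact_eq_cocompact, ← Metric.cobounded_eq_cocompact]
    exact tendsto_norm_atTop_iff_cobounded.mp hnorm

end SingularValues

end

theorem mainTheorem4 :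
    (∀ f : ℂ → ℂ, SingularValues.IsTranscendentalMeromorphic f →
      (SingularValues.singularValues f).Finite →
      (∃ a : OnePoint ℂ, SingularValues.IsAsymptoticValue f a) →
      0 < SingularValues.lowerGrowth f) ∧
    (∀ f : ℂ → ℂ, Differentiable ℂ f → ¬ SingularValues.IsRational f →
      (SingularValues.singularValues f).Finite →
      0 < SingularValues.lowerGrowth f) := by
  refine ⟨fun f ⟨hf, hrat⟩ hfin ⟨a, ha⟩ => ?_, fun f hf hrat hfin => ?_⟩
  · induction a using OnePoint.rec with
    | infty => exact SingularValues.lowerGrowth_pos_of_isAsymptoticValue_infty hf hrat hfin ha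
    | coe a => exact SingularValues.lowerGrowth_pos_of_isAsymptoticValue_coe hf hrat hfin ha
  · exact SingularValues.lowerGrowth_pos_of_isAsymptoticValue_infty
      (fun z => (hf.analyticAt z).meromorphicAt) hrat hfin
      (SingularValues.isAsymptoticValue_infty_of_differentiable hf hrat hfin)
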